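/- Let $n\ge 1$ and $L\ge 0$ be integers. The matchgate group ${\rm Spin}(2n)\subseteq \mathbb{U}((\mathbb{C}^2)^{\otimes n})$ is the (compact) group generated by the unitaries $e^{i\theta Z_j}$ ($1\le j\le n$) and $e^{i\theta X_jX_{j+1}}$ ($1\le j\le n-1$), $\theta\in\mathbb{R}$, for $n$ qubits on a line. A depth-$L$ ($2$-local) matchgate circuit is a product of $L$ time-steps, each of which is a product of gates acting on pairwise disjoint sets of qubits, every gate being an element of ${\rm Spin}(2n)$ that acts non-trivially only on one qubit or on two neighbouring qubits (idle time-steps are allowed). For a probability distribution $\mathcal{E}$ on $\mathbb{U}((\mathbb{C}^2)^{\otimes n})$ let $\phi^{(2)}_{\mathcal{E}}(A)=\mathbb{E}_{U\sim\mathcal{E}}\big[U^{\otimes 2}A(U^\dagger)^{\otimes 2}\big]$, and let $\phi^{(2)}_{{\rm Spin}(2n)}$ be the same channel for the Haar probability measure on ${\rm Spin}(2n)$. The diamond distance is $\|\phi-\phi'\|_\diamond=\sup_\rho\|((\phi-\phi')\otimes\mathcal{I}_{\rm anc})(\rho)\|_1$, the supremum being over all finite-dimensional ancillas and all states $\rho$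 of system and ancilla; $\mathcal{E}$ is an $\varepsilon$-approximate matchgate $2$-design if $\|\phi^{(2)}_{\mathcal{E}}-\phi^{(2)}_{{\rm Spin}(2n)}\|_\diamond\le\varepsilon$. Let $\mathcal{E}$ be any ensemble (probability distribution) of depth-$L$ matchgate circuits. If $L<n/2$, then $$\big\|\phi^{(2)}_{\mathcal{E}}-\phi^{(2)}_{{\rm Spin}(2n)}\big\|_\diamond\;\ge\;2-\frac{n+1}{2n-1}.$$ Consequently, if $\mathcal{E}$ is an $\varepsilon$-approximate matchgate $2$-design for some $0\le\varepsilon<2-\frac{n+1}{2n-1}$ (a bound that is at least $1$ for every $n\ge 2$ and tends to $3/2$ as $n\to\infty$), then $L\ge n/2$. -/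

import Mathlib

open MeasureTheory
open scoped Kronecker ComplexOrder ENNReal

noncomputable section

/-! ### Measures on the unitary group -/

section General

variable {ι : Type} [Fintype ι] [DecidableEq ι]

instance unitaryGroupMeasurableSpace : MeasurableSpace (Matrix.unitaryGroup ι ℂ) := borel _

instance unitaryGroupBorelSpace : BorelSpace (Matrix.unitaryGroup ι ℂ) := ⟨rfl⟩

instance unitaryGroupCompactSpace : CompactSpace (Matrix.unitaryGroup ι ℂ) := by
  have hclosed : IsClosed ((Matrix.unitaryGroup ι ℂ : Submonoid (Matrix ι ι ℂ)) :
      Set (Matrix ι ι ℂ)) := by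
    have h : ((Matrix.unitaryGroup ι ℂ : Submonoid (Matrix ι ι ℂ)) : Set (Matrix ι ι ℂ)) =
        {A | A * star A = 1} := by
      ext A
      exact Matrix.mem_unitaryGroup_iff
    rw [h]
    exact isClosed_eq (continuous_id.mul continuous_star) continuous_const
  have hbox : IsCompact (Set.pi Set.univ fun _ : ι =>
      Set.pi Set.univ fun _ : ι => Metric.closedBall (0 : ℂ) 1) :=
    isCompact_univ_pi fun _ => isCompact_univ_pi fun _ => isCompact_closedBall _ _
  refine isCompact_iff_compactSpace.mp (hbox.of_isClosed_subset hclosed ?_)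
  intro A hA i _ j _
  simpa using entry_norm_bound_of_unitary hA i j

/-- The normalised Haar measure of a closed (hence compact) group `G` of unitaries, regarded as a
probability measure on the whole unitary group. -/
def haarEnsemble (G : Subgroup (Matrix.unitaryGroup ι ℂ))
    (hG : IsClosed (G : Set (Matrix.unitaryGroup ι ℂ))) : Measure (Matrix.unitaryGroup ι ℂ) :=
  haveI : CompactSpace G := isCompact_iff_compactSpace.mp hG.isCompact
  (Measure.haarMeasure (⊤ : TopologicalSpace.PositiveCompacts G)).map Subtype.val

instance haarEnsemble_isProbabilityMeasure (G : Subgroup (Matrix.unitaryGroup ι ℂ))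
    (hG : IsClosed (G : Set (Matrix.unitaryGroup ι ℂ))) :
    IsProbabilityMeasure (haarEnsemble G hG) := by
  have : CompactSpace G := isCompact_iff_compactSpace.mp hG.isCompact
  have : IsProbabilityMeasure
      (Measure.haarMeasure (⊤ : TopologicalSpace.PositiveCompacts G)) :=
    ⟨Measure.haarMeasure_self⟩
  exact Measure.isProbabilityMeasure_map continuous_subtype_val.measurable.aemeasurable

/-! ### Moment channels -/

/-- `U^{⊗2} A (U^{⊗2})†`. -/
def conjTwo (U : Matrix.unitaryGroup ι ℂ) (A : Matrix (ι × ι) (ι × ι) ℂ) :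
    Matrix (ι × ι) (ι × ι) ℂ :=
  ((U : Matrix ι ι ℂ) ⊗ₖ (U : Matrix ι ι ℂ)) * A *
    ((U : Matrix ι ι ℂ) ⊗ₖ (U : Matrix ι ι ℂ)).conjTranspose

theorem integrable_conjTwo (ν : Measure (Matrix.unitaryGroup ι ℂ)) [IsFiniteMeasure ν]
    (A : Matrix (ι × ι) (ι × ι) ℂ) (p q : ι × ι) : Integrable (fun U => conjTwo U A p q) ν := by
  have hcont : Continuous fun U : Matrix.unitaryGroup ι ℂ => conjTwo U A p q := by
    have hW : Continuous fun U : Matrix.unitaryGroup ι ℂ =>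
        ((U : Matrix ι ι ℂ) ⊗ₖ (U : Matrix ι ι ℂ)) := by
      refine continuous_matrix fun a b => ?_
      simp only [Matrix.kroneckerMap_apply]
      exact (continuous_subtype_val.matrix_elem _ _).mul (continuous_subtype_val.matrix_elem _ _)
    exact ((hW.mul continuous_const).mul hW.matrix_conjTranspose).matrix_elem p q
  exact hcont.integrable_of_hasCompactSupport (HasCompactSupport.of_compactSpace _)

/-- The second moment channel `A ↦ 𝔼_{U ∼ ν} [U^{⊗2} A (U^{⊗2})†]`; the (matrix-valued)
expectation is taken entry by entry. -/
def momentChannel (ν : Measure (Matrix.unitaryGroup ι ℂ)) [IsFiniteMeasure ν] :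
    Matrix (ι × ι) (ι × ι) ℂ →ₗ[ℂ] Matrix (ι × ι) (ι × ι) ℂ where
  toFun A := Matrix.of fun p q => ∫ U, conjTwo U A p q ∂ν
  map_add' A B := by
    ext p q
    have h : ∀ U : Matrix.unitaryGroup ι ℂ,
        conjTwo U (A + B) p q = conjTwo U A p q + conjTwo U B p q := by
      intro U
      simp [conjTwo, mul_add, add_mul]
    simp only [Matrix.of_apply, Matrix.add_apply, h]
    exact integral_add (integrable_conjTwo ν A p q) (integrable_conjTwo ν B p q)
  map_smul' c A := by
    ext p q
    have h : ∀ U : Matrix.unitaryGroup ι ℂ, conjTwo U (c • A) p q = c * conjTwo U A p q := by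
      intro U
      simp [conjTwo]
    simp only [Matrix.of_apply, Matrix.smul_apply, h, RingHom.id_apply, smul_eq_mul]
    exact integral_const_mul c _

/-! ### Trace norm, diamond norm, approximate designs -/

/-- The trace norm `‖A‖₁ = Tr √(A†A)`, i.e. the sum of the singular values of `A`. -/
def traceNorm {κ : Type} [Fintype κ] [DecidableEq κ] (A : Matrix κ κ ℂ) : ℝ :=
  ∑ i, Real.sqrt ((Matrix.isHermitian_conjTranspose_mul_self A).eigenvalues i)

/-- `Φ ⊗ id`, acting on operators on the system together with an ancilla indexed by `κ`. -/
def tensorAncilla {σ κ : Type} (Φ : Matrix σ σ ℂ →ₗ[ℂ] Matrix σ σ ℂ)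
    (ρ : Matrix (σ × κ) (σ × κ) ℂ) : Matrix (σ × κ) (σ × κ) ℂ :=
  Matrix.of fun p q => Φ (Matrix.of fun i j => ρ (i, p.2) (j, q.2)) p.1 q.1

/-- A quantum state (density matrix). -/
def IsState {κ : Type} [Fintype κ] (ρ : Matrix κ κ ℂ) : Prop :=
  ρ.PosSemidef ∧ ρ.trace = 1

/-- The diamond norm: the supremum of `‖(Φ ⊗ id)(ρ)‖₁` over all finite-dimensional ancillas
`ℂ^m` and all states `ρ` of system and ancilla. -/
def diamondNorm {σ : Type} [Fintype σ] [DecidableEq σ]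
    (Φ : Matrix σ σ ℂ →ₗ[ℂ] Matrix σ σ ℂ) : ℝ≥0∞ :=
  ⨆ (m : ℕ) (ρ : Matrix (σ × Fin m) (σ × Fin m) ℂ) (_ : IsState ρ),
    ENNReal.ofReal (traceNorm (tensorAncilla Φ ρ))

/-- The diamond distance between the second moment channels of `ν` and of the Haar measure
on `G`. -/
def twoDesignDistance (G : Subgroup (Matrix.unitaryGroup ι ℂ))
    (hG : IsClosed (G : Set (Matrix.unitaryGroup ι ℂ)))
    (ν : Measure (Matrix.unitaryGroup ι ℂ)) [IsFiniteMeasure ν] : ℝ≥0∞ :=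
  diamondNorm (momentChannel ν - momentChannel (haarEnsemble G hG))

/-- `ν` is an additive `ε`-approximate `2`-design over `G`. -/
def IsApproxTwoDesign (G : Subgroup (Matrix.unitaryGroup ι ℂ))
    (hG : IsClosed (G : Set (Matrix.unitaryGroup ι ℂ)))
    (ε : ℝ) (ν : Measure (Matrix.unitaryGroup ι ℂ)) [IsFiniteMeasure ν] : Prop :=
  twoDesignDistance G hG ν ≤ ENNReal.ofReal ε

end General

/-! ### Qubits on a line and the matchgate group -/

/-- Computational basis labels of `n` qubits; `(ℂ²)^{⊗n}` has this basis. -/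
abbrev Bits (n : ℕ) : Type := Fin n → Fin 2

/-- Unitaries on `n` qubits. -/
abbrev QubitUnitary (n : ℕ) : Type := Matrix.unitaryGroup (Bits n) ℂ

/-- The one-qubit operator `A` acting on qubit `j`, and the identity on all other qubits. -/
def onQubit {n : ℕ} (j : Fin n) (A : Matrix (Fin 2) (Fin 2) ℂ) : Matrix (Bits n) (Bits n) ℂ :=
  Matrix.of fun x y => if ∀ i, i ≠ j → x i = y i then A (x j) (y j) else 0

/-- Pauli `X` on qubit `j`. -/
def pauliX {n : ℕ} (j : Fin n) : Matrix (Bits n) (Bits n) ℂ := onQubit j !![0, 1; 1, 0]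

/-- Pauli `Z` on qubit `j`. -/
def pauliZ {n : ℕ} (j : Fin n) : Matrix (Bits n) (Bits n) ℂ := onQubit j !![1, 0; 0, -1]

/-- The generators of the matchgate group: the rotations `exp(iθ Z_j)` and
`exp(iθ X_j X_{j+1})`. -/
def matchgateGenerators (n : ℕ) : Set (QubitUnitary n) :=
  {U | (∃ (j : Fin n) (θ : ℝ),
        (U : Matrix (Bits n) (Bits n) ℂ) = NormedSpace.exp ((Complex.I * θ) • pauliZ j)) ∨
      ∃ (j k : Fin n) (θ : ℝ), (j : ℕ) + 1 = k ∧
        (U : Matrix (Bits n) (Bits n) ℂ) =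
          NormedSpace.exp ((Complex.I * θ) • (pauliX j * pauliX k))}

/-- The matchgate group `Spin(2n)`, as the closed subgroup of the unitary group generated by the
matchgate generators. (The group they generate algebraically is a compact Lie group, so taking
the topological closure does not change it.) -/
def matchgateGroup (n : ℕ) : Subgroup (QubitUnitary n) :=
  (Subgroup.closure (matchgateGenerators n)).topologicalClosure

theorem isClosed_matchgateGroup (n : ℕ) :
    IsClosed (matchgateGroup n : Set (QubitUnitary n)) :=
  Subgroup.isClosed_topologicalClosure _

/-! ### Circuits -/

/-- The operator `U` acts non-trivially only on the qubits in `S`: it is of the form `A ⊗ 1`,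
with `A` acting on the qubits in `S`. -/
def IsSupportedOn {n : ℕ} (S : Finset (Fin n)) (U : Matrix (Bits n) (Bits n) ℂ) : Prop :=
  ∃ A : Matrix (S → Fin 2) (S → Fin 2) ℂ, ∀ x y : Bits n,
    U x y = if ∀ i, i ∉ S → x i = y i then A (fun i => x i) (fun i => y i) else 0

/-- A `2`-local gate of the group `G` on a line of qubits: an element of `G` that acts only on the
qubits in `S`, where `S` is contained in a pair of neighbouring qubits. -/
def IsLocalGate {n : ℕ} (G : Subgroup (QubitUnitary n)) (S : Finset (Fin n))
    (U : QubitUnitary n) : Prop :=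
  U ∈ G ∧ IsSupportedOn S (U : Matrix (Bits n) (Bits n) ℂ) ∧
    ∃ j : Fin n, ∀ i ∈ S, i = j ∨ (i : ℕ) = j + 1

/-- One time-step of a circuit: a product of `2`-local gates of `G` acting on pairwise disjoint
sets of qubits. -/
def IsLayer {n : ℕ} (G : Subgroup (QubitUnitary n)) (U : QubitUnitary n) : Prop :=
  ∃ gates : List (Finset (Fin n) × QubitUnitary n),
    gates.Pairwise (fun g h => Disjoint g.1 h.1) ∧
      (∀ g ∈ gates, IsLocalGate G g.1 g.2) ∧ U = (gates.map Prod.snd).prod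

/-- `U` is implemented by a circuit of depth `L` consisting of `2`-local gates of `G`.
Time-steps may be idle, so this includes all circuits of smaller depth. -/
def IsCircuitOfDepth {n : ℕ} (G : Subgroup (QubitUnitary n)) (L : ℕ) (U : QubitUnitary n) : Prop :=
  ∃ layers : List (QubitUnitary n),
    layers.length = L ∧ (∀ W ∈ layers, IsLayer G W) ∧ U = layers.prod

end

/-! In the Jordan–Wigner picture a matchgate unitary conjugates each Majorana operator into a linear
combination of Majorana operators, so it also acts linearly on bivectors, the products of two
distinct ones. A two-copy state can carry this action. There is a charge conjugation C with U C Uᵀ =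
C on the matchgate group, hence (U ⊗ U) vec(A C) = vec(U A U† C). The test state is the normalised
vec(γ₀γ₁C), with both Majoranas on the leftmost site.

A circuit of depth L spreads a Majorana from site 0 over at most L + 1 sites
(`IsLayer.conjOp_mem_majoranaSpan`), so the evolved state stays in the span of the bivectors on the
first 2(L + 1) Majoranas (`IsCircuitOfDepth.conjOp_bivector_mem`). Under Haar measure all n(2n - 1)
bivectors are equally likely, because quarter turns exchange consecutive Majoranas up to sign
(`haarOverlap_bivector`). By Bessel each has probability at most 1/(n(2n - 1)). If 2L < n, then 2(L
+ 1) ≤ n + 1 and the span is hit with probability p ≤ (n + 1)/(2(2n - 1)).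

Measuring the projection onto this span tells the ensembles apart, with probability one against p,
so the diamond distance is at least 2 - 2p (`ofReal_le_diamondNorm_sub`). -/

noncomputable section

/-! ### Lower bounds for the trace and diamond norms -/

section TraceNorm

variable {κ : Type} [Fintype κ] [DecidableEq κ]

/-- In an eigenbasis of A†A the columns of V A have the singular values of A as their norms, and
each diagonal entry is bounded by the norm of its column. -/
theorem re_trace_mul_le_traceNorm (A V : Matrix κ κ ℂ) (hV : V.conjTranspose * V = 1) :
    (V * A).trace.re ≤ traceNorm A := by
  set hA := Matrix.isHermitian_conjTranspose_mul_self A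
  set Q : Matrix κ κ ℂ := (hA.eigenvectorUnitary : Matrix κ κ ℂ)
  have hQ : Q * Q.conjTranspose = 1 := Unitary.mul_star_self_of_mem hA.eigenvectorUnitary.2
  have hdiag : Q.conjTranspose * (A.conjTranspose * A) * Q =
      Matrix.diagonal (fun i => ((hA.eigenvalues i : ℝ) : ℂ)) := by
    have := hA.conjStarAlgAut_star_eigenvectorUnitary
    rw [Unitary.conjStarAlgAut_star_apply] at this
    exact this
  set X := Q.conjTranspose * (V * A) * Q
  have hX : X.conjTranspose * X = Matrix.diagonal (fun i => ((hA.eigenvalues i : ℝ) : ℂ)) := by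
    rw [← hdiag]
    simp only [X, Matrix.conjTranspose_mul, Matrix.conjTranspose_conjTranspose]
    calc _ = Q.conjTranspose * (A.conjTranspose * V.conjTranspose * (Q * Q.conjTranspose) *
          (V * A)) * Q := by simp only [mul_assoc]
      _ = Q.conjTranspose * (A.conjTranspose * (V.conjTranspose * V) * A) * Q := by
          rw [hQ]; simp only [mul_assoc, mul_one]
      _ = _ := by rw [hV, mul_one]
  have htr : (V * A).trace = X.trace := by
    rw [Matrix.trace_mul_comm (Q.conjTranspose * (V * A)) Q, ← mul_assoc, hQ, one_mul]
  rw [htr, Matrix.trace, Complex.re_sum]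
  refine Finset.sum_le_sum fun i _ => ?_
  have h1 : ∑ j, ‖X j i‖ ^ 2 = hA.eigenvalues i := by
    have := congrFun (congrFun hX i) i
    simp only [Matrix.mul_apply, Matrix.conjTranspose_apply, Matrix.diagonal_apply_eq] at this
    have h2 : ∀ j, star (X j i) * X j i = ((‖X j i‖ ^ 2 : ℝ) : ℂ) := by
      intro j
      rw [RCLike.star_def, Complex.conj_mul']
      simp
    simp only [h2] at this
    exact_mod_cast this
  refine (Complex.re_le_norm _).trans (Real.le_sqrt_of_sq_le ?_)
  rw [← h1]
  exact Finset.single_le_sum (f := fun j => ‖X j i‖ ^ 2) (fun j _ => by positivity)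
    (Finset.mem_univ i)

/-- A one-dimensional ancilla suffices: the test state is already entangled between the two copies,
and no further reference system is needed. -/
theorem ofReal_re_trace_mul_le_diamondNorm (Φ : Matrix κ κ ℂ →ₗ[ℂ] Matrix κ κ ℂ)
    (ρ V : Matrix κ κ ℂ) (hρ : IsState ρ) (hV : V.conjTranspose * V = 1) :
    ENNReal.ofReal (V * Φ ρ).trace.re ≤ diamondNorm Φ := by
  have hmul : ∀ A B : Matrix κ κ ℂ,
      A.submatrix (Prod.fst : κ × Fin 1 → κ) (Prod.fst : κ × Fin 1 → κ) *
      B.submatrix (Prod.fst : κ × Fin 1 → κ) (Prod.fst : κ × Fin 1 → κ) =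
        (A * B).submatrix Prod.fst Prod.fst := by
    intro A B
    ext p q
    simp [Matrix.mul_apply, Fintype.sum_prod_type]
  have htr : ∀ A : Matrix κ κ ℂ, (A.submatrix (Prod.fst : κ × Fin 1 → κ) Prod.fst).trace =
      A.trace := by
    intro A
    simp [Matrix.trace, Fintype.sum_prod_type]
  have hstate : IsState (ρ.submatrix (Prod.fst : κ × Fin 1 → κ) Prod.fst) :=
    ⟨hρ.1.submatrix _, by rw [htr, hρ.2]⟩
  refine le_trans (ENNReal.ofReal_le_ofReal ?_) (le_iSup_of_le 1 (le_iSup_of_le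
    (ρ.submatrix (Prod.fst : κ × Fin 1 → κ) Prod.fst) (le_iSup_of_le hstate le_rfl)))
  have : tensorAncilla Φ (ρ.submatrix (Prod.fst : κ × Fin 1 → κ) Prod.fst) =
      (Φ ρ).submatrix Prod.fst Prod.fst := rfl
  rw [this, ← htr (V * Φ ρ), ← hmul]
  refine re_trace_mul_le_traceNorm _ _ ?_
  rw [Matrix.conjTranspose_submatrix, hmul, hV]
  ext ⟨a, i⟩ ⟨b, j⟩
  simp [Matrix.one_apply, Subsingleton.elim i j]

end TraceNorm

/-! ### Moment channels and Haar invariance -/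

section Moment

variable {ι : Type} [Fintype ι] [DecidableEq ι]

theorem trace_mul_momentChannel (ν : Measure (Matrix.unitaryGroup ι ℂ)) [IsFiniteMeasure ν]
    (M A : Matrix (ι × ι) (ι × ι) ℂ) :
    (M * momentChannel ν A).trace = ∫ U, (M * conjTwo U A).trace ∂ν := by
  have hΦ : ∀ p q, momentChannel ν A p q = ∫ U, conjTwo U A p q ∂ν := fun _ _ => rfl
  simp only [Matrix.trace, Matrix.diag, Matrix.mul_apply, hΦ]
  refine ((integral_finsetSum Finset.univ fun p _ => integrable_finsetSum _ fun q _ =>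
    (integrable_conjTwo ν A q p).const_mul _).trans (Finset.sum_congr rfl fun p _ =>
    (integral_finsetSum Finset.univ fun q _ =>
      (integrable_conjTwo ν A q p).const_mul _).trans
    (Finset.sum_congr rfl fun q _ => integral_const_mul _ _))).symm

theorem trace_conjTwo (U : Matrix.unitaryGroup ι ℂ) (A : Matrix (ι × ι) (ι × ι) ℂ) :
    (conjTwo U A).trace = A.trace := by
  rw [conjTwo, Matrix.trace_mul_comm, ← mul_assoc, Matrix.conjTranspose_kronecker,
    ← Matrix.mul_kronecker_mul]
  have : (U : Matrix ι ι ℂ).conjTranspose * U = 1 := Unitary.star_mul_self_of_mem U.2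
  rw [this, Matrix.one_kronecker_one, one_mul]

theorem ae_mem_haarEnsemble (G : Subgroup (Matrix.unitaryGroup ι ℂ))
    (hG : IsClosed (G : Set (Matrix.unitaryGroup ι ℂ))) :
    ∀ᵐ U ∂haarEnsemble G hG, U ∈ G := by
  rw [haarEnsemble, ae_map_iff (p := fun U => U ∈ G)
    continuous_subtype_val.measurable.aemeasurable hG.measurableSet]
  exact Filter.Eventually.of_forall fun U => U.2

theorem integral_haarEnsemble_mul_left (G : Subgroup (Matrix.unitaryGroup ι ℂ))
    (hG : IsClosed (G : Set (Matrix.unitaryGroup ι ℂ))) {g : Matrix.unitaryGroup ι ℂ}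
    (hg : g ∈ G) (h : Matrix.unitaryGroup ι ℂ → ℝ) (hh : Continuous h) :
    ∫ U, h (g * U) ∂haarEnsemble G hG = ∫ U, h U ∂haarEnsemble G hG := by
  have : CompactSpace G := isCompact_iff_compactSpace.mp hG.isCompact
  rw [haarEnsemble, integral_map continuous_subtype_val.measurable.aemeasurable
    hh.aestronglyMeasurable, integral_map continuous_subtype_val.measurable.aemeasurable
    (show Continuous fun U => h (g * U) from
      hh.comp (continuous_const.mul continuous_id)).aestronglyMeasurable]
  exact integral_mul_left_eq_self
    (μ := Measure.haarMeasure (⊤ : TopologicalSpace.PositiveCompacts G))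
    (fun U : G => h U) ⟨g, hg⟩

end Moment

/-! ### Orthonormal families and distinguishing ensembles by a projection -/

section Projection

/-- The sum of the rank-one operators `|v i⟩⟨v i|`, `i ∈ S`. -/
def frameProj {κ ι : Type} (S : Finset ι) (v : ι → κ → ℂ) : Matrix κ κ ℂ :=
  ∑ i ∈ S, Matrix.vecMulVec (v i) (star (v i))

theorem frameProj_conjTranspose {κ ι : Type} (S : Finset ι) (v : ι → κ → ℂ) :
    (frameProj S v).conjTranspose = frameProj S v := by
  simp [frameProj, Matrix.conjTranspose_sum, Matrix.conjTranspose_vecMulVec]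

theorem frameProj_mulVec {κ ι : Type} [Fintype κ] (S : Finset ι) (v : ι → κ → ℂ) (w : κ → ℂ) :
    (frameProj S v).mulVec w = ∑ i ∈ S, (star (v i) ⬝ᵥ w) • v i := by
  simp [frameProj, Matrix.sum_mulVec, Matrix.vecMulVec_mulVec]

/-- The family `v` is orthonormal on `S`. -/
def IsOrthonormalOn {κ ι : Type} [Fintype κ] [DecidableEq ι] (S : Finset ι) (v : ι → κ → ℂ) :
    Prop :=
  ∀ i ∈ S, ∀ j ∈ S, star (v i) ⬝ᵥ v j = if i = j then 1 else 0

variable {κ ι : Type} [Fintype κ] [DecidableEq ι] {S : Finset ι} {v : ι → κ → ℂ}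

theorem IsOrthonormalOn.mono {T : Finset ι} (hv : IsOrthonormalOn T v) (hST : S ⊆ T) :
    IsOrthonormalOn S v :=
  fun i hi j hj => hv i (hST hi) j (hST hj)

theorem IsOrthonormalOn.frameProj_mulVec_self (hv : IsOrthonormalOn S v) {i : ι} (hi : i ∈ S) :
    (frameProj S v).mulVec (v i) = v i := by
  rw [frameProj_mulVec, Finset.sum_eq_single_of_mem i hi]
  · simp [hv i hi i hi]
  · intro j hj hji
    simp [hv j hj i hi, hji]

theorem IsOrthonormalOn.frameProj_mulVec_of_mem_span (hv : IsOrthonormalOn S v) {w : κ → ℂ}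
    (hw : w ∈ Submodule.span ℂ (v '' S)) : (frameProj S v).mulVec w = w := by
  induction hw using Submodule.span_induction with
  | mem x hx =>
    obtain ⟨i, hi, rfl⟩ := hx
    exact hv.frameProj_mulVec_self hi
  | zero => simp
  | add x y _ _ hx hy => rw [Matrix.mulVec_add, hx, hy]
  | smul c x _ hx => rw [Matrix.mulVec_smul, hx]

theorem IsOrthonormalOn.frameProj_mul_self (hv : IsOrthonormalOn S v) :
    frameProj S v * frameProj S v = frameProj S v := by
  have : frameProj S v * (∑ i ∈ S, Matrix.vecMulVec (v i) (star (v i))) =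
      ∑ i ∈ S, Matrix.vecMulVec (v i) (star (v i)) := by
    rw [Finset.mul_sum]
    refine Finset.sum_congr rfl fun i hi => ?_
    rw [Matrix.mul_vecMulVec, hv.frameProj_mulVec_self hi]
  exact this

theorem star_dotProduct_frameProj_mulVec {κ ι : Type} [Fintype κ] (S : Finset ι) (v : ι → κ → ℂ)
    (w : κ → ℂ) :
    star w ⬝ᵥ (frameProj S v).mulVec w = ((∑ i ∈ S, ‖star (v i) ⬝ᵥ w‖ ^ 2 : ℝ) : ℂ) := by
  rw [frameProj_mulVec, dotProduct_sum]
  push_cast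
  refine Finset.sum_congr rfl fun i _ => ?_
  rw [dotProduct_smul, smul_eq_mul, ← Complex.mul_conj']
  congr 1
  rw [← RCLike.star_def, Matrix.star_dotProduct]

/-- Bessel's inequality: 1 - P is a self-adjoint idempotent, hence positive semidefinite. -/
theorem IsOrthonormalOn.sum_norm_sq_le [DecidableEq κ] (hv : IsOrthonormalOn S v) (w : κ → ℂ) :
    ∑ i ∈ S, ‖star (v i) ⬝ᵥ w‖ ^ 2 ≤ (star w ⬝ᵥ w).re := by
  have hsq : (1 - frameProj S v).conjTranspose * (1 - frameProj S v) = 1 - frameProj S v := by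
    rw [Matrix.conjTranspose_sub, Matrix.conjTranspose_one, frameProj_conjTranspose, mul_sub,
      sub_mul, sub_mul, hv.frameProj_mul_self]
    simp
  have h := (Matrix.posSemidef_conjTranspose_mul_self (1 - frameProj S v)).re_dotProduct_nonneg w
  rw [hsq, Matrix.sub_mulVec, dotProduct_sub, Matrix.one_mulVec,
    star_dotProduct_frameProj_mulVec] at h
  simpa only [RCLike.re_to_complex, Complex.sub_re, Complex.ofReal_re, sub_nonneg] using h

theorem trace_frameProj_mul_conjTwo {ι κ : Type} [Fintype κ] [DecidableEq κ] [DecidableEq ι]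
    (S : Finset ι) (v : ι → κ × κ → ℂ) (ψ : κ × κ → ℂ) (U : Matrix.unitaryGroup κ ℂ) :
    (frameProj S v * conjTwo U (Matrix.vecMulVec ψ (star ψ))).trace =
      ((∑ i ∈ S, ‖star (v i) ⬝ᵥ
        ((U : Matrix κ κ ℂ) ⊗ₖ (U : Matrix κ κ ℂ)).mulVec ψ‖ ^ 2 : ℝ) : ℂ) := by
  set w := ((U : Matrix κ κ ℂ) ⊗ₖ (U : Matrix κ κ ℂ)).mulVec ψ
  have : conjTwo U (Matrix.vecMulVec ψ (star ψ)) = Matrix.vecMulVec w (star w) := by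
    rw [conjTwo, Matrix.mul_vecMulVec, Matrix.vecMulVec_mul, Matrix.star_mulVec]
  rw [this, Matrix.mul_vecMulVec, Matrix.trace_vecMulVec, dotProduct_comm,
    star_dotProduct_frameProj_mulVec]

/-- Two ensembles whose evolved pure states land in the span of an orthonormal family with
probability one, respectively at most `p`, have second moment channels at diamond distance at
least `2 - 2p`. -/
theorem ofReal_le_diamondNorm_sub {ι κ : Type} [Fintype κ] [DecidableEq κ] [DecidableEq ι]
    (ν μ : Measure (Matrix.unitaryGroup κ ℂ)) [IsProbabilityMeasure ν] [IsProbabilityMeasure μ]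
    {S : Finset ι} {v : ι → κ × κ → ℂ} (hv : IsOrthonormalOn S v) {i₀ : ι} (hi₀ : i₀ ∈ S) (p : ℝ)
    (hνspan : ∀ᵐ U : Matrix.unitaryGroup κ ℂ ∂ν, ((U : Matrix κ κ ℂ) ⊗ₖ (U : Matrix κ κ ℂ)).mulVec (v i₀) ∈
      Submodule.span ℂ (v '' S))
    (hμ : ∫ U : Matrix.unitaryGroup κ ℂ, ∑ i ∈ S, ‖star (v i) ⬝ᵥ
      ((U : Matrix κ κ ℂ) ⊗ₖ (U : Matrix κ κ ℂ)).mulVec (v i₀)‖ ^ 2 ∂μ ≤ p) :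
    ENNReal.ofReal (2 - 2 * p) ≤ diamondNorm (momentChannel ν - momentChannel μ) := by
  set P := frameProj S v
  set ψ := v i₀
  set ρ := Matrix.vecMulVec ψ (star ψ)
  have hψ : star ψ ⬝ᵥ ψ = 1 := by simp [ψ, hv i₀ hi₀ i₀ hi₀]
  have htrρ : ρ.trace = 1 := by rw [Matrix.trace_vecMulVec, dotProduct_comm, hψ]
  have hρ : IsState ρ := ⟨Matrix.posSemidef_vecMulVec_self_star ψ, htrρ⟩
  -- The reflection 2P - 1 is the test unitary: against a state its trace is twice the probability
  -- of P, minus 1.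
  have hV : ((2 : ℂ) • P - 1).conjTranspose * ((2 : ℂ) • P - 1) = 1 := by
    rw [Matrix.conjTranspose_sub, Matrix.conjTranspose_smul, frameProj_conjTranspose]
    simp only [Matrix.conjTranspose_one, mul_sub, sub_mul, Matrix.smul_mul, Matrix.mul_smul,
      hv.frameProj_mul_self, P, star_ofNat, mul_one, one_mul]
    module
  refine le_trans (ENNReal.ofReal_le_ofReal ?_)
    (ofReal_re_trace_mul_le_diamondNorm _ ρ ((2 : ℂ) • P - 1) hρ hV)
  have hV' : ∀ (η : Measure (Matrix.unitaryGroup κ ℂ)) [IsProbabilityMeasure η],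
      (((2 : ℂ) • P - 1) * momentChannel η ρ).trace.re =
        2 * (∫ U : Matrix.unitaryGroup κ ℂ, ∑ i ∈ S, ‖star (v i) ⬝ᵥ
          ((U : Matrix κ κ ℂ) ⊗ₖ (U : Matrix κ κ ℂ)).mulVec ψ‖ ^ 2 ∂η) - 1 := by
    intro η _
    have h1 : (P * momentChannel η ρ).trace =
        ((∫ U : Matrix.unitaryGroup κ ℂ, ∑ i ∈ S, ‖star (v i) ⬝ᵥ
          ((U : Matrix κ κ ℂ) ⊗ₖ (U : Matrix κ κ ℂ)).mulVec ψ‖ ^ 2 ∂η : ℝ) : ℂ) := by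
      rw [trace_mul_momentChannel, ← integral_complex_ofReal]
      simp only [P, ρ, trace_frameProj_mul_conjTwo]
    have h2 : (momentChannel η ρ).trace = 1 := by
      rw [← one_mul (momentChannel η ρ), trace_mul_momentChannel]
      simp [trace_conjTwo, htrρ]
    rw [sub_mul, one_mul, Matrix.smul_mul, Matrix.trace_sub, Matrix.trace_smul, h1, h2]
    simp
  -- P fixes the evolved vector, so the sum is its squared norm, which conjugation by U ⊗ U leaves
  -- equal to 1.
  have hνint : ∫ U : Matrix.unitaryGroup κ ℂ, ∑ i ∈ S, ‖star (v i) ⬝ᵥ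
      ((U : Matrix κ κ ℂ) ⊗ₖ (U : Matrix κ κ ℂ)).mulVec ψ‖ ^ 2 ∂ν = 1 := by
    have : ∀ᵐ U : Matrix.unitaryGroup κ ℂ ∂ν, ∑ i ∈ S, ‖star (v i) ⬝ᵥ
        ((U : Matrix κ κ ℂ) ⊗ₖ (U : Matrix κ κ ℂ)).mulVec ψ‖ ^ 2 = 1 := by
      filter_upwards [hνspan] with U hU
      have h3 := star_dotProduct_frameProj_mulVec S v
        (((U : Matrix κ κ ℂ) ⊗ₖ (U : Matrix κ κ ℂ)).mulVec ψ)
      rw [hv.frameProj_mulVec_of_mem_span hU, dotProduct_comm, ← Matrix.trace_vecMulVec] at h3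
      have h4 := trace_conjTwo U ρ
      rw [htrρ, conjTwo, Matrix.mul_vecMulVec, Matrix.vecMulVec_mul, ← Matrix.star_mulVec, h3]
        at h4
      exact_mod_cast h4
    rw [integral_congr_ae this]
    simp
  rw [LinearMap.sub_apply, mul_sub, Matrix.trace_sub, Complex.sub_re, hV' ν, hV' μ, hνint]
  linarith

end Projection

/-! ### Pauli strings over bit vectors -/

section PauliStrings

/-- The bicharacter `(-1)^{ab}` on bits. -/
def bitSign (a b : Fin 2) : ℂ := if a = 1 ∧ b = 1 then -1 else 1

theorem bitSign_comm (a b : Fin 2) : bitSign a b = bitSign b a := by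
  simp only [bitSign, and_comm]

theorem bitSign_add_right (a b c : Fin 2) : bitSign a (b + c) = bitSign a b * bitSign a c := by
  fin_cases a <;> fin_cases b <;> fin_cases c <;> simp [bitSign]

theorem bit_add_self (a : Fin 2) : a + a = 0 := by
  revert a; decide

variable {n : ℕ}

theorem bits_add_self (u : Bits n) : u + u = 0 := funext fun i => bit_add_self (u i)

theorem bits_add_add_cancel (x u : Bits n) : x + u + u = x := by
  rw [add_assoc, bits_add_self, add_zero]

theorem bits_eq_add_iff (x y u : Bits n) : x = y + u ↔ y = x + u :=
  ⟨fun h => by rw [h, bits_add_add_cancel], fun h => by rw [h, bits_add_add_cancel]⟩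

/-- The bicharacter `(-1)^{v · y}` on bit strings. -/
def bitsSign (v y : Bits n) : ℂ := ∏ i, bitSign (v i) (y i)

theorem bitsSign_comm (v y : Bits n) : bitsSign v y = bitsSign y v :=
  Finset.prod_congr rfl fun _ _ => bitSign_comm _ _

theorem bitsSign_add_right (v y z : Bits n) :
    bitsSign v (y + z) = bitsSign v y * bitsSign v z := by
  simp only [bitsSign, ← Finset.prod_mul_distrib, Pi.add_apply, bitSign_add_right]

theorem bitsSign_add_left (v w y : Bits n) :
    bitsSign (v + w) y = bitsSign v y * bitsSign w y := by
  rw [bitsSign_comm, bitsSign_add_right, bitsSign_comm y, bitsSign_comm y]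

@[simp] theorem bitsSign_zero_right (v : Bits n) : bitsSign v 0 = 1 := by
  simp [bitsSign, bitSign]

@[simp] theorem bitsSign_zero_left (v : Bits n) : bitsSign 0 v = 1 := by
  simp [bitsSign, bitSign]

theorem bitsSign_mul_self (v y : Bits n) : bitsSign v y * bitsSign v y = 1 := by
  rw [← bitsSign_add_right, bits_add_self, bitsSign_zero_right]

theorem star_bitsSign (v y : Bits n) : star (bitsSign v y) = bitsSign v y := by
  simp only [bitsSign, star_prod]
  refine Finset.prod_congr rfl fun i _ => ?_
  unfold bitSign
  split_ifs <;> simp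

/-- The Pauli string that flips the bits in `u` after applying the phases `(-1)^{v · y}`. -/
def pauliString (u v : Bits n) : Matrix (Bits n) (Bits n) ℂ :=
  Matrix.of fun x y => if x = y + u then bitsSign v y else 0

theorem pauliString_apply (u v x y : Bits n) :
    pauliString u v x y = if x = y + u then bitsSign v y else 0 := rfl

theorem pauliString_mul (u v u' v' : Bits n) :
    pauliString u v * pauliString u' v' =
      bitsSign v u' • pauliString (u + u') (v + v') := by
  ext x y
  rw [Matrix.mul_apply, Finset.sum_eq_single (y + u')]
  · simp only [pauliString_apply, Matrix.smul_apply, if_true, smul_eq_mul, bitsSign_add_right,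
      bitsSign_add_left, ← add_assoc, add_right_comm y u' u]
    split_ifs <;> ring
  · intro z _ hz
    simp [pauliString_apply, hz]
  · simp

@[simp] theorem pauliString_zero : pauliString (0 : Bits n) 0 = 1 := by
  ext x y
  simp [pauliString_apply, Matrix.one_apply]

theorem pauliString_conjTranspose (u v : Bits n) :
    (pauliString u v).conjTranspose = bitsSign v u • pauliString u v := by
  ext x y
  simp only [Matrix.conjTranspose_apply, pauliString_apply, Matrix.smul_apply, smul_eq_mul,
    bits_eq_add_iff y x u]
  split_ifs with h
  · rw [star_bitsSign, h, bitsSign_add_right, mul_comm]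
  · simp

theorem pauliString_conjTranspose_mul_self (u v : Bits n) :
    (pauliString u v).conjTranspose * pauliString u v = 1 := by
  rw [pauliString_conjTranspose, Matrix.smul_mul, pauliString_mul, smul_smul, bitsSign_mul_self,
    bits_add_self, bits_add_self, pauliString_zero, one_smul]

theorem pauliString_zero_left_transpose (v : Bits n) :
    (pauliString 0 v).transpose = pauliString 0 v := by
  ext x y
  simp only [Matrix.transpose_apply, pauliString_apply, add_zero, eq_comm (a := y)]
  split_ifs with h
  · rw [h]
  · rfl

theorem pauliString_zero_right_transpose (u : Bits n) :
    (pauliString u 0).transpose = pauliString u 0 := by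
  ext x y
  simp [Matrix.transpose_apply, pauliString_apply, bits_eq_add_iff y x u]

theorem pauliString_mul_comm (u v u' v' : Bits n) :
    pauliString u v * pauliString u' v' =
      (bitsSign v u' * bitsSign v' u) • (pauliString u' v' * pauliString u v) := by
  rw [pauliString_mul, pauliString_mul, smul_smul, mul_assoc, bitsSign_mul_self, mul_one,
    add_comm u, add_comm v]

/-- An operator supported on `S` commutes with Pauli strings that are trivial on `S`. -/
theorem IsSupportedOn.commute_pauliString {S : Finset (Fin n)} {A : Matrix (Bits n) (Bits n) ℂ}
    (hA : IsSupportedOn S A) {u v : Bits n} (hu : ∀ i ∈ S, u i = 0) (hv : ∀ i ∈ S, v i = 0) :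
    A * pauliString u v = pauliString u v * A := by
  obtain ⟨B, hB⟩ := hA
  ext x y
  rw [Matrix.mul_apply, Finset.sum_eq_single (y + u), Matrix.mul_apply,
    Finset.sum_eq_single (x + u)]
  · simp only [pauliString_apply, bits_add_add_cancel, if_true, hB, Pi.add_apply]
    have hcond : (∀ i, i ∉ S → x i = y i + u i) ↔ ∀ i, i ∉ S → x i + u i = y i := by
      refine forall₂_congr fun i _ => ⟨fun h => ?_, fun h => ?_⟩
      · rw [h, add_assoc, bit_add_self, add_zero]
      · rw [← h, add_assoc, bit_add_self, add_zero]
    by_cases h : ∀ i, i ∉ S → x i + u i = y i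
    · rw [if_pos (hcond.2 h), if_pos h, mul_comm]
      congr 1
      · refine Finset.prod_congr rfl fun i _ => ?_
        by_cases hi : i ∈ S
        · simp [hv i hi, bitSign]
        · rw [Pi.add_apply, h i hi]
      · congr 1 <;> ext i <;> simp [hu i i.2]
    · rw [if_neg (mt hcond.1 h), if_neg h]
      simp
  · intro z _ hz
    rw [pauliString_apply, if_neg, zero_mul]
    rwa [bits_eq_add_iff]
  · simp
  · intro z _ hz
    rw [pauliString_apply, if_neg hz, mul_zero]
  · simp

/-- The indicator of the site `m`. -/
def siteBits (n m : ℕ) : Bits n := fun i => if (i : ℕ) = m then 1 else 0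

/-- The indicator of the sites below `m`. -/
def lowBits (n m : ℕ) : Bits n := fun i => if (i : ℕ) < m then 1 else 0

theorem bitsSign_siteBits (v : Bits n) {m : ℕ} (hm : m < n) :
    bitsSign v (siteBits n m) = if v ⟨m, hm⟩ = 1 then -1 else 1 := by
  rw [bitsSign, Finset.prod_eq_single (⟨m, hm⟩ : Fin n)]
  · simp [bitSign, siteBits]
  · intro i _ hi
    have : (i : ℕ) ≠ m := fun h => hi (Fin.ext h)
    simp [bitSign, siteBits, this]
  · simp

/-- The basic Jordan–Wigner sign: a string of Zs on the sites below k anticommutes with a flip at m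
exactly when the string covers m. -/
theorem bitsSign_lowBits_siteBits {k m : ℕ} (hm : m < n) :
    bitsSign (lowBits n k) (siteBits n m) = if m < k then -1 else 1 := by
  rw [bitsSign_siteBits _ hm]
  by_cases h : m < k <;> simp [lowBits, h]

theorem lowBits_add_lowBits_succ (m : ℕ) : lowBits n m + lowBits n (m + 1) = siteBits n m := by
  ext i
  simp only [Pi.add_apply, lowBits, siteBits]
  rcases lt_trichotomy (i : ℕ) m with h | h | h
  · simp [h, h.ne, h.trans (Nat.lt_succ_self m)]
  · simp [h]
  · simp [h.not_gt, h.ne', Nat.not_lt.2 (Nat.succ_le_of_lt h)]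

theorem pauliX_eq_pauliString (j : Fin n) : pauliX j = pauliString (siteBits n j) 0 := by
  ext x y
  simp only [pauliX, onQubit, Matrix.of_apply, pauliString_apply, bitsSign_zero_left]
  have key : ∀ a b : Fin 2, (!![0, 1; 1, 0] : Matrix (Fin 2) (Fin 2) ℂ) a b =
      if a = b + 1 then 1 else 0 := by
    intro a b
    fin_cases a <;> fin_cases b <;> simp
  have hiff : x = y + siteBits n j ↔ (∀ i, i ≠ j → x i = y i) ∧ x j = y j + 1 := by
    constructor
    · rintro rfl
      refine ⟨fun i hi => ?_, by simp [siteBits]⟩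
      have : (i : ℕ) ≠ j := fun h => hi (Fin.ext h)
      simp [siteBits, this]
    · rintro ⟨h1, h2⟩
      ext1 i
      by_cases hi : i = j
      · subst hi; simp [siteBits, h2]
      · have : (i : ℕ) ≠ j := fun h => hi (Fin.ext h)
        simp [siteBits, this, h1 i hi]
  refine (congrArg (fun t => if ∀ i, i ≠ j → x i = y i then t else (0 : ℂ))
    (key (x j) (y j))).trans ?_
  by_cases h : ∀ i, i ≠ j → x i = y i
  · rw [if_pos h]
    exact if_congr (by rw [hiff]; exact ⟨fun h' => ⟨h, h'⟩, fun h' => h'.2⟩) rfl rfl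
  · rw [if_neg h, if_neg fun h' => h (hiff.1 h').1]

theorem pauliZ_eq_pauliString (j : Fin n) : pauliZ j = pauliString 0 (siteBits n j) := by
  ext x y
  simp only [pauliZ, onQubit, Matrix.of_apply, pauliString_apply, add_zero]
  rw [bitsSign_comm, bitsSign_siteBits y j.2]
  by_cases h : x = y
  · subst h
    simp only [implies_true, if_true]
    have key : ∀ a : Fin 2, (!![1, 0; 0, -1] : Matrix (Fin 2) (Fin 2) ℂ) a a =
        if a = 1 then -1 else 1 := by
      intro a
      fin_cases a <;> simp
    exact key _
  · rw [if_neg h]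
    split_ifs with h'
    · have hj : x j ≠ y j := by
        intro hj
        refine h (funext fun i => ?_)
        by_cases hi : i = j
        · rw [hi, hj]
        · exact h' i hi
      have key : ∀ a b : Fin 2, a ≠ b → (!![1, 0; 0, -1] : Matrix (Fin 2) (Fin 2) ℂ) a b = 0 := by
        intro a b hab
        fin_cases a <;> fin_cases b <;> simp_all
      exact key _ _ hj
    · rfl

end PauliStrings

/-! ### Majorana operators, parity and charge conjugation -/

section Majorana

/-- The Jordan–Wigner Majorana operators: `majorana n (2 * j)` is `Z₀ ⋯ Z_{j-1} X_j` and
`majorana n (2 * j + 1)` is `Z₀ ⋯ Z_{j-1} Y_j`. -/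
def majorana (n k : ℕ) : Matrix (Bits n) (Bits n) ℂ :=
  (if k % 2 = 0 then 1 else Complex.I) •
    pauliString (siteBits n (k / 2)) (lowBits n ((k + 1) / 2))

variable {n : ℕ}

/-- For an odd label the string covers the operator's own site, where X and Z anticommute; the
prefactor `Complex.I` compensates this sign. -/
theorem majorana_conjTranspose {k : ℕ} (hk : k < 2 * n) :
    (majorana n k).conjTranspose = majorana n k := by
  rw [majorana, Matrix.conjTranspose_smul, pauliString_conjTranspose, smul_smul,
    bitsSign_lowBits_siteBits (by omega)]
  congr 1
  rcases Nat.mod_two_eq_zero_or_one k with h | h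
  · rw [if_pos h, if_neg (by omega)]; simp
  · rw [if_neg (by omega), if_pos (by omega)]; simp

theorem majorana_mul_self {k : ℕ} (hk : k < 2 * n) : majorana n k * majorana n k = 1 := by
  rw [majorana, Matrix.smul_mul, Matrix.mul_smul, pauliString_mul, bits_add_self, bits_add_self,
    pauliString_zero, smul_smul, smul_smul, bitsSign_lowBits_siteBits (by omega)]
  rcases Nat.mod_two_eq_zero_or_one k with h | h
  · rw [if_pos h, if_neg (by omega)]; simp
  · rw [if_neg (by omega), if_pos (by omega)]; simp

/-- Of the two crossing signs only one is -1: the string of the larger label covers the site of the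
smaller label, and never conversely. -/
theorem majorana_anticomm {a b : ℕ} (ha : a < 2 * n) (hb : b < 2 * n) (hab : a ≠ b) :
    majorana n a * majorana n b = -(majorana n b * majorana n a) := by
  simp only [majorana, Matrix.smul_mul, Matrix.mul_smul]
  rw [pauliString_mul_comm, bitsSign_lowBits_siteBits (by omega),
    bitsSign_lowBits_siteBits (by omega)]
  have : ((if b / 2 < (a + 1) / 2 then -1 else 1) * (if a / 2 < (b + 1) / 2 then -1 else 1) : ℂ)
      = -1 := by
    rcases lt_or_gt_of_ne hab with h | h
    · rw [if_neg (by omega), if_pos (by omega)]; simp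
    · rw [if_pos (by omega), if_neg (by omega)]; simp
  rw [this]
  module

/-- The strings of consecutive Majoranas cancel up to a local factor. Together with
`majorana_odd_mul_even` this identifies the generators Z_j and X_jX_{j+1} with consecutive
bivectors, up to a phase. -/
theorem majorana_even_mul_odd {j : ℕ} (hj : j < n) :
    majorana n (2 * j) * majorana n (2 * j + 1) =
      Complex.I • pauliString 0 (siteBits n j) := by
  have h1 : 2 * j / 2 = j := by omega
  have h2 : (2 * j + 1) / 2 = j := by omega
  have h3 : (2 * j + 1 + 1) / 2 = j + 1 := by omega
  have h4 : (2 * j + 1) % 2 ≠ 0 := by omega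
  simp only [majorana, h1, h2, h3, h4, Nat.mul_mod_right, if_true, if_false, one_smul,
    Matrix.mul_smul, pauliString_mul, bits_add_self, lowBits_add_lowBits_succ,
    bitsSign_lowBits_siteBits hj, lt_irrefl]

theorem majorana_odd_mul_even {j : ℕ} (hj : j + 1 < n) :
    majorana n (2 * j + 1) * majorana n (2 * j + 1 + 1) =
      Complex.I • pauliString (siteBits n j + siteBits n (j + 1)) 0 := by
  have h1 : (2 * j + 1 + 1) % 2 = 0 := by omega
  have h2 : (2 * j + 1) / 2 = j := by omega
  have h3 : (2 * j + 1 + 1) / 2 = j + 1 := by omega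
  have h4 : (2 * j + 1) % 2 ≠ 0 := by omega
  have h5 : (2 * j + 1 + 1 + 1) / 2 = j + 1 := by omega
  simp only [majorana, h1, h2, h3, h4, h5, if_true, if_false, one_smul, Matrix.smul_mul,
    pauliString_mul, bits_add_self, bitsSign_lowBits_siteBits hj, lt_irrefl]

/-- The fermion parity `∏ Z_j`. -/
def parityOp (n : ℕ) : Matrix (Bits n) (Bits n) ℂ := pauliString 0 (lowBits n n)

/-- The charge conjugation intertwining a matchgate unitary with its complex conjugate. -/
def chargeConj (n : ℕ) : Matrix (Bits n) (Bits n) ℂ :=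
  pauliString (lowBits n n) (fun i => if (i : ℕ) % 2 = 0 then 0 else 1)

theorem parityOp_mul_self : parityOp n * parityOp n = 1 := by
  rw [parityOp, pauliString_mul, bits_add_self, bits_add_self]
  simp

theorem chargeConj_mul_conjTranspose : chargeConj n * (chargeConj n).conjTranspose = 1 :=
  mul_eq_one_comm.1 (pauliString_conjTranspose_mul_self _ _)

theorem majorana_succ_cases {k : ℕ} (hk : k + 1 < 2 * n) :
    (∃ j, j < n ∧ k = 2 * j) ∨ ∃ j, j + 1 < n ∧ k = 2 * j + 1 := by
  rcases Nat.mod_two_eq_zero_or_one k with h | h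
  · exact Or.inl ⟨k / 2, by omega, by omega⟩
  · exact Or.inr ⟨k / 2, by omega, by omega⟩

theorem parityOp_commute_majorana_mul_succ {k : ℕ} (hk : k + 1 < 2 * n) :
    majorana n k * majorana n (k + 1) * parityOp n =
      parityOp n * (majorana n k * majorana n (k + 1)) := by
  rcases majorana_succ_cases hk with ⟨j, hj, rfl⟩ | ⟨j, hj, rfl⟩
  · rw [majorana_even_mul_odd hj, parityOp, Matrix.smul_mul, pauliString_mul_comm,
      Matrix.mul_smul]
    simp
  · rw [majorana_odd_mul_even hj, parityOp, Matrix.smul_mul, pauliString_mul_comm,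
      Matrix.mul_smul, bitsSign_add_right, bitsSign_lowBits_siteBits hj,
      bitsSign_lowBits_siteBits (by omega), if_pos hj, if_pos (by omega)]
    simp

/-- The infinitesimal form of U C Uᵀ = C. Both kinds of generator are symmetric matrices. C flips
every bit, so it anticommutes with Z_j; its Zs sit on the odd sites, exactly one of which lies in
{j, j + 1}, so it anticommutes with X_jX_{j+1}. -/
theorem chargeConj_anticomm {k : ℕ} (hk : k + 1 < 2 * n) :
    majorana n k * majorana n (k + 1) * chargeConj n =
      -(chargeConj n * (majorana n k * majorana n (k + 1)).transpose) := by
  rcases majorana_succ_cases hk with ⟨j, hj, rfl⟩ | ⟨j, hj, rfl⟩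
  · rw [majorana_even_mul_odd hj, chargeConj, Matrix.transpose_smul,
      pauliString_zero_left_transpose, Matrix.smul_mul, pauliString_mul_comm,
      Matrix.mul_smul, bitsSign_comm (siteBits n j), bitsSign_lowBits_siteBits hj, if_pos hj]
    simp
  · rw [majorana_odd_mul_even hj, chargeConj, Matrix.transpose_smul,
      pauliString_zero_right_transpose, Matrix.smul_mul, pauliString_mul_comm,
      Matrix.mul_smul, bitsSign_add_right, bitsSign_siteBits _ hj,
      bitsSign_siteBits _ (show j < n by omega)]
    rcases Nat.mod_two_eq_zero_or_one j with h | h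
    · have h' : (j + 1) % 2 = 1 := by omega
      simp [h, h']
    · have h' : (j + 1) % 2 = 0 := by omega
      simp [h, h']

/-- Every matchgate generator is a rotation generated by two consecutive Majorana operators. -/
theorem matchgateGenerator_eq_exp {U : QubitUnitary n} (hU : U ∈ matchgateGenerators n) :
    ∃ (k : ℕ) (θ : ℝ), k + 1 < 2 * n ∧ (U : Matrix (Bits n) (Bits n) ℂ) =
      NormedSpace.exp (θ • (majorana n k * majorana n (k + 1))) := by
  rcases hU with ⟨j, θ, h⟩ | ⟨j, k, θ, hjk, h⟩
  · refine ⟨2 * j, θ, by omega, ?_⟩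
    rw [h, majorana_even_mul_odd j.2, pauliZ_eq_pauliString, mul_comm, mul_smul,
      Complex.coe_smul]
  · refine ⟨2 * j + 1, θ, by omega, ?_⟩
    rw [h, majorana_odd_mul_even (by omega), pauliX_eq_pauliString, pauliX_eq_pauliString,
      pauliString_mul, bitsSign_zero_left, one_smul, add_zero, mul_comm, mul_smul,
      Complex.coe_smul, hjk]

/-- Every rotation generated by two consecutive Majorana operators is a matchgate generator,
provided it is unitary. -/
theorem exp_mem_matchgateGenerators {k : ℕ} (hk : k + 1 < 2 * n) (θ : ℝ) {U : QubitUnitary n}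
    (hU : (U : Matrix (Bits n) (Bits n) ℂ) =
      NormedSpace.exp (θ • (majorana n k * majorana n (k + 1)))) :
    U ∈ matchgateGenerators n := by
  rcases majorana_succ_cases hk with ⟨j, hj, rfl⟩ | ⟨j, hj, rfl⟩
  · refine Or.inl ⟨⟨j, hj⟩, θ, ?_⟩
    rw [hU, majorana_even_mul_odd hj, pauliZ_eq_pauliString, mul_comm, mul_smul,
      Complex.coe_smul]
  · refine Or.inr ⟨⟨j, by omega⟩, ⟨j + 1, hj⟩, θ, rfl, ?_⟩
    rw [hU, majorana_odd_mul_even hj, pauliX_eq_pauliString, pauliX_eq_pauliString,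
      pauliString_mul, bitsSign_zero_left, one_smul, add_zero, mul_comm, mul_smul,
      Complex.coe_smul]

end Majorana

/-! ### Exponentials of complex structures and conjugation maps -/

section Rotations

/-- Since J squares to -1, sending the imaginary unit to J defines a continuous real algebra
homomorphism from ℂ, which carries Euler's formula to matrices. -/
theorem exp_smul_of_mul_self_eq_neg_one {κ : Type} [Fintype κ] [DecidableEq κ]
    (J : Matrix κ κ ℂ) (hJ : J * J = -1) (θ : ℝ) :
    NormedSpace.exp (θ • J) = Real.cos θ • 1 + Real.sin θ • J := by
  let _ : NormedRing (Matrix κ κ ℂ) := Matrix.linftyOpNormedRing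
  let _ : NormedAlgebra ℝ (Matrix κ κ ℂ) := Matrix.linftyOpNormedAlgebra
  let _ : NormedAlgebra ℚ (Matrix κ κ ℂ) := NormedAlgebra.restrictScalars ℚ ℝ _
  set f : ℂ →ₐ[ℝ] Matrix κ κ ℂ := Complex.lift ⟨J, hJ⟩
  have hf : ∀ z : ℂ, f z = z.re • (1 : Matrix κ κ ℂ) + z.im • J := by
    intro z
    simp [f, Complex.liftAux_apply, Algebra.algebraMap_eq_smul_one]
  have hcont : Continuous f := f.toLinearMap.continuous_of_finiteDimensional
  have h := NormedSpace.map_exp f hcont (θ * Complex.I)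
  rw [hf, hf, ← Complex.exp_eq_exp_ℂ] at h
  simp only [Complex.exp_ofReal_mul_I_re, Complex.exp_ofReal_mul_I_im, Complex.re_ofReal_mul,
    Complex.im_ofReal_mul, Complex.I_re, Complex.I_im, mul_zero, mul_one, zero_smul, zero_add] at h
  exact h.symm

/-- Conjugation `A ↦ U A U†`. -/
def conjOp {κ : Type} [Fintype κ] (U : Matrix κ κ ℂ) : Matrix κ κ ℂ →ₗ[ℂ] Matrix κ κ ℂ where
  toFun A := U * A * U.conjTranspose
  map_add' A B := by rw [mul_add, add_mul]
  map_smul' c A := by simp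

section ConjOp

variable {κ : Type} [Fintype κ]

theorem conjOp_apply (U A : Matrix κ κ ℂ) : conjOp U A = U * A * U.conjTranspose := rfl

theorem conjOp_mul_apply (U V A : Matrix κ κ ℂ) : conjOp (U * V) A = conjOp U (conjOp V A) := by
  simp only [conjOp_apply, Matrix.conjTranspose_mul, mul_assoc]

theorem conjOp_one [DecidableEq κ] (A : Matrix κ κ ℂ) : conjOp 1 A = A := by
  simp [conjOp_apply]

variable [DecidableEq κ] (U : Matrix.unitaryGroup κ ℂ)

theorem unitary_conjTranspose_mul_self : (U : Matrix κ κ ℂ).conjTranspose * U = 1 :=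
  Unitary.star_mul_self_of_mem U.2

theorem unitary_mul_conjTranspose : (U : Matrix κ κ ℂ) * (U : Matrix κ κ ℂ).conjTranspose = 1 :=
  Unitary.mul_star_self_of_mem U.2

theorem conjOp_mul (A B : Matrix κ κ ℂ) :
    conjOp (U : Matrix κ κ ℂ) (A * B) = conjOp (U : Matrix κ κ ℂ) A * conjOp (U : Matrix κ κ ℂ) B := by
  simp only [conjOp_apply]
  calc _ = (U : Matrix κ κ ℂ) * A * 1 * B * (U : Matrix κ κ ℂ).conjTranspose := by
        simp only [mul_assoc, one_mul]
    _ = _ := by rw [← unitary_conjTranspose_mul_self U]; simp only [mul_assoc]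

theorem conjOp_eq_self_of_commute {A : Matrix κ κ ℂ} (h : (U : Matrix κ κ ℂ) * A = A * U) :
    conjOp (U : Matrix κ κ ℂ) A = A := by
  rw [conjOp_apply, h, mul_assoc, unitary_mul_conjTranspose, mul_one]

theorem trace_conjOp (A : Matrix κ κ ℂ) : (conjOp (U : Matrix κ κ ℂ) A).trace = A.trace := by
  rw [conjOp_apply, Matrix.trace_mul_comm, ← mul_assoc, unitary_conjTranspose_mul_self, one_mul]

end ConjOp

end Rotations

/-! ### Invariants of the matchgate group and its action on Majoranas -/

section MatchgateGroup

variable {n : ℕ}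

theorem majorana_mul_succ_sq {k : ℕ} (hk : k + 1 < 2 * n) :
    majorana n k * majorana n (k + 1) * (majorana n k * majorana n (k + 1)) = -1 := by
  have h := majorana_anticomm hk (show k < 2 * n by omega) (by omega)
  calc _ = majorana n k * (majorana n (k + 1) * majorana n k) * majorana n (k + 1) := by
        simp only [mul_assoc]
    _ = -(majorana n k * majorana n k * (majorana n (k + 1) * majorana n (k + 1))) := by
        rw [h]; simp only [mul_neg, neg_mul, mul_assoc]
    _ = -1 := by rw [majorana_mul_self hk, majorana_mul_self (by omega), one_mul]

theorem majorana_mul_succ_conjTranspose {k : ℕ} (hk : k + 1 < 2 * n) :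
    (majorana n k * majorana n (k + 1)).conjTranspose = -(majorana n k * majorana n (k + 1)) := by
  rw [Matrix.conjTranspose_mul, majorana_conjTranspose hk, majorana_conjTranspose (by omega),
    majorana_anticomm hk (show k < 2 * n by omega) (by omega)]

/-- The rotation by `θ` in the plane of two consecutive Majorana operators. -/
def majoranaRotation (n k : ℕ) (θ : ℝ) : Matrix (Bits n) (Bits n) ℂ :=
  Real.cos θ • 1 + Real.sin θ • (majorana n k * majorana n (k + 1))

theorem majoranaRotation_conjTranspose {k : ℕ} (hk : k + 1 < 2 * n) (θ : ℝ) :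
    (majoranaRotation n k θ).conjTranspose = majoranaRotation n k (-θ) := by
  rw [majoranaRotation, majoranaRotation, Matrix.conjTranspose_add, Matrix.conjTranspose_smul,
    Matrix.conjTranspose_smul, majorana_mul_succ_conjTranspose hk]
  simp

theorem majoranaRotation_eq_exp {k : ℕ} (hk : k + 1 < 2 * n) (θ : ℝ) :
    majoranaRotation n k θ = NormedSpace.exp (θ • (majorana n k * majorana n (k + 1))) :=
  (exp_smul_of_mul_self_eq_neg_one _ (majorana_mul_succ_sq hk) θ).symm

theorem majoranaRotation_mem_unitaryGroup {k : ℕ} (hk : k + 1 < 2 * n) (θ : ℝ) :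
    majoranaRotation n k θ ∈ Matrix.unitaryGroup (Bits n) ℂ := by
  rw [Matrix.mem_unitaryGroup_iff, Matrix.star_eq_conjTranspose,
    majoranaRotation_conjTranspose hk]
  simp only [majoranaRotation, mul_add, add_mul, Matrix.smul_mul, Matrix.mul_smul, mul_one, one_mul,
    majorana_mul_succ_sq hk, Real.cos_neg, Real.sin_neg, smul_smul, smul_neg]
  have h := Real.cos_sq_add_sin_sq θ
  have h1 : (1 : Matrix (Bits n) (Bits n) ℂ) = (Real.cos θ ^ 2 + Real.sin θ ^ 2) • 1 := by
    rw [h, one_smul]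
  conv_rhs => rw [h1]
  module

theorem majoranaRotation_mem_matchgateGroup {k : ℕ} (hk : k + 1 < 2 * n) (θ : ℝ) :
    (⟨majoranaRotation n k θ, majoranaRotation_mem_unitaryGroup hk θ⟩ : QubitUnitary n) ∈
      matchgateGroup n :=
  Subgroup.le_topologicalClosure _ (Subgroup.subset_closure
    (exp_mem_matchgateGenerators hk θ (majoranaRotation_eq_exp hk θ)))

/-- A closed multiplicative property of unitaries that holds for the rotations of consecutive
Majorana operators holds on the matchgate group. -/
theorem matchgateGroup_induction {p : QubitUnitary n → Prop} (hclosed : IsClosed {U | p U})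
    (hone : p 1) (hmul : ∀ U V, p U → p V → p (U * V))
    (hgen : ∀ (k : ℕ) (θ : ℝ) (U : QubitUnitary n), k + 1 < 2 * n →
      (U : Matrix (Bits n) (Bits n) ℂ) = majoranaRotation n k θ → p U)
    {U : QubitUnitary n} (hU : U ∈ matchgateGroup n) : p U := by
  -- Inverses need no hypothesis of their own: the inverse of a rotation is the rotation by -θ.
  have hgen' : ∀ U ∈ matchgateGenerators n, p U ∧ p U⁻¹ := by
    intro U hU
    obtain ⟨k, θ, hk, h⟩ := matchgateGenerator_eq_exp hU
    rw [← majoranaRotation_eq_exp hk] at h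
    refine ⟨hgen k θ U hk h, hgen k (-θ) _ hk ?_⟩
    rw [← majoranaRotation_conjTranspose hk, ← h]
    rfl
  have hsub : (Subgroup.closure (matchgateGenerators n) : Set (QubitUnitary n)) ⊆ {U | p U} := by
    intro V hV
    have hV' : V ∈ Submonoid.closure (matchgateGenerators n ∪ (matchgateGenerators n)⁻¹) := by
      rw [← Subgroup.closure_toSubmonoid]
      exact hV
    induction hV' using Submonoid.closure_induction with
    | mem x hx =>
      rcases hx with hx | hx
      · exact (hgen' x hx).1
      · simpa using (hgen' x⁻¹ hx).2
    | one => exact hone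
    | mul x y hx hy hpx hpy =>
      have hmem : ∀ z ∈ Submonoid.closure (matchgateGenerators n ∪ (matchgateGenerators n)⁻¹),
          z ∈ Subgroup.closure (matchgateGenerators n) := by
        intro z hz
        rwa [← Subgroup.closure_toSubmonoid] at hz
      exact hmul x y (hpx (hmem x hx)) (hpy (hmem y hy))
  exact closure_minimal hsub hclosed hU

theorem continuous_coe_unitary {κ : Type} [Fintype κ] [DecidableEq κ] :
    Continuous fun U : Matrix.unitaryGroup κ ℂ => (U : Matrix κ κ ℂ) := continuous_subtype_val

theorem continuous_conjOp {κ : Type} [Fintype κ] [DecidableEq κ] (A : Matrix κ κ ℂ) :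
    Continuous fun U : Matrix.unitaryGroup κ ℂ => conjOp (U : Matrix κ κ ℂ) A :=
  (continuous_coe_unitary.mul continuous_const).mul continuous_coe_unitary.matrix_conjTranspose

theorem matchgateGroup_commute_parityOp {U : QubitUnitary n} (hU : U ∈ matchgateGroup n) :
    (U : Matrix (Bits n) (Bits n) ℂ) * parityOp n = parityOp n * U := by
  refine matchgateGroup_induction
    (p := fun U : QubitUnitary n => (U : Matrix (Bits n) (Bits n) ℂ) * parityOp n = parityOp n * U)
    (isClosed_eq (continuous_coe_unitary.mul continuous_const)
      (continuous_const.mul continuous_coe_unitary)) (by simp) ?_ ?_ hU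
  · intro U V hU hV
    rw [Submonoid.coe_mul, mul_assoc, hV, ← mul_assoc, hU, mul_assoc]
  · intro k θ U hk h
    rw [h, majoranaRotation, add_mul, mul_add, Matrix.smul_mul, Matrix.smul_mul, Matrix.mul_smul,
      Matrix.mul_smul, parityOp_commute_majorana_mul_succ hk, one_mul, mul_one]

/-- For a rotation cos θ + sin θ J the cross terms cancel by `chargeConj_anticomm`. The same
relation and J² = -1 give J C Jᵀ = C, so the square terms add up to C. -/
theorem matchgateGroup_mul_chargeConj {U : QubitUnitary n} (hU : U ∈ matchgateGroup n) :
    (U : Matrix (Bits n) (Bits n) ℂ) * chargeConj n *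
      (U : Matrix (Bits n) (Bits n) ℂ).transpose = chargeConj n := by
  refine matchgateGroup_induction (p := fun U : QubitUnitary n => (U : Matrix (Bits n) (Bits n) ℂ) * chargeConj n *
      (U : Matrix (Bits n) (Bits n) ℂ).transpose = chargeConj n)
    (isClosed_eq ((continuous_coe_unitary.mul continuous_const).mul
      continuous_coe_unitary.matrix_transpose) continuous_const) (by simp) ?_ ?_ hU
  · intro U V hU hV
    rw [Submonoid.coe_mul, Matrix.transpose_mul]
    calc _ = (U : Matrix (Bits n) (Bits n) ℂ) * ((V : Matrix (Bits n) (Bits n) ℂ) * chargeConj n *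
          (V : Matrix (Bits n) (Bits n) ℂ).transpose) *
            (U : Matrix (Bits n) (Bits n) ℂ).transpose := by simp only [mul_assoc]
      _ = _ := by rw [hV, hU]
  · intro k θ U hk h
    rw [h, majoranaRotation]
    set J := majorana n k * majorana n (k + 1) with hJdef
    have hJ : J * chargeConj n = -(chargeConj n * J.transpose) := chargeConj_anticomm hk
    have hJ2 : J * J = -1 := majorana_mul_succ_sq hk
    have hJC : J * chargeConj n * J.transpose = chargeConj n := by
      have : chargeConj n * J.transpose = -(J * chargeConj n) := by rw [hJ, neg_neg]
      rw [mul_assoc, this, mul_neg, ← mul_assoc, hJ2, neg_one_mul, neg_neg]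
    simp only [Matrix.transpose_add, Matrix.transpose_smul, Matrix.transpose_one, mul_add, add_mul,
      Matrix.smul_mul, Matrix.mul_smul, mul_one, one_mul, hJC]
    rw [hJ]
    have h1 : chargeConj n = (Real.cos θ ^ 2 + Real.sin θ ^ 2) • chargeConj n := by
      rw [Real.cos_sq_add_sin_sq θ, one_smul]
    conv_rhs => rw [h1]
    module

section Action

variable {k a : ℕ}

theorem majorana_commute_of_ne (hk : k + 1 < 2 * n) (ha : a < 2 * n) (h1 : a ≠ k)
    (h2 : a ≠ k + 1) :
    majorana n k * majorana n (k + 1) * majorana n a =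
      majorana n a * (majorana n k * majorana n (k + 1)) := by
  rw [mul_assoc, majorana_anticomm hk ha h2.symm, mul_neg, ← mul_assoc,
    majorana_anticomm (show k < 2 * n by omega) ha h1.symm, neg_mul, neg_neg, mul_assoc]

theorem conjOp_majoranaRotation_of_ne (hk : k + 1 < 2 * n) (ha : a < 2 * n) (h1 : a ≠ k)
    (h2 : a ≠ k + 1) (θ : ℝ) : conjOp (majoranaRotation n k θ) (majorana n a) = majorana n a := by
  refine conjOp_eq_self_of_commute
    ⟨majoranaRotation n k θ, majoranaRotation_mem_unitaryGroup hk θ⟩ ?_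
  simp only [majoranaRotation, add_mul, mul_add, Matrix.smul_mul, Matrix.mul_smul, one_mul, mul_one,
    majorana_commute_of_ne hk ha h1 h2]

/-- The angle doubles, as in the covering of the rotation group by the spin group. -/
theorem conjOp_majoranaRotation_self (hk : k + 1 < 2 * n) (θ : ℝ) :
    conjOp (majoranaRotation n k θ) (majorana n k) =
      Real.cos (2 * θ) • majorana n k - Real.sin (2 * θ) • majorana n (k + 1) := by
  have hk' : k < 2 * n := by omega
  have e1 : majorana n k * majorana n (k + 1) * majorana n k = -majorana n (k + 1) := by
    rw [mul_assoc, majorana_anticomm hk hk' (by omega), mul_neg, ← mul_assoc,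
      majorana_mul_self hk', one_mul]
  have e2 : majorana n k * (majorana n k * majorana n (k + 1)) = majorana n (k + 1) := by
    rw [← mul_assoc, majorana_mul_self hk', one_mul]
  have e3 : majorana n (k + 1) * (majorana n k * majorana n (k + 1)) = -majorana n k := by
    rw [← mul_assoc, majorana_anticomm hk hk' (by omega), neg_mul, mul_assoc,
      majorana_mul_self hk, mul_one]
  rw [conjOp_apply, majoranaRotation_conjTranspose hk, Real.cos_two_mul', Real.sin_two_mul]
  simp only [majoranaRotation, add_mul, mul_add, Matrix.smul_mul, Matrix.mul_smul, one_mul, mul_one,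
    e1, e2, e3, neg_mul, Real.cos_neg, Real.sin_neg, smul_neg]
  module

theorem conjOp_majoranaRotation_succ (hk : k + 1 < 2 * n) (θ : ℝ) :
    conjOp (majoranaRotation n k θ) (majorana n (k + 1)) =
      Real.cos (2 * θ) • majorana n (k + 1) + Real.sin (2 * θ) • majorana n k := by
  have hk' : k < 2 * n := by omega
  have e1 : majorana n k * majorana n (k + 1) * majorana n (k + 1) = majorana n k := by
    rw [mul_assoc, majorana_mul_self hk, mul_one]
  have e2 : majorana n k * (majorana n k * majorana n (k + 1)) = majorana n (k + 1) := by
    rw [← mul_assoc, majorana_mul_self hk', one_mul]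
  have e3 : majorana n (k + 1) * (majorana n k * majorana n (k + 1)) = -majorana n k := by
    rw [← mul_assoc, majorana_anticomm hk hk' (by omega), neg_mul, mul_assoc,
      majorana_mul_self hk, mul_one]
  rw [conjOp_apply, majoranaRotation_conjTranspose hk, Real.cos_two_mul', Real.sin_two_mul]
  simp only [majoranaRotation, add_mul, mul_add, Matrix.smul_mul, Matrix.mul_smul, one_mul, mul_one,
    e1, e2, e3, Real.cos_neg, Real.sin_neg, smul_neg]
  module

end Action

/-- The span of the Majorana operators with labels in `T`. -/
def majoranaSpan (n : ℕ) (T : Set ℕ) : Submodule ℂ (Matrix (Bits n) (Bits n) ℂ) :=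
  Submodule.span ℂ (majorana n '' T)

theorem majorana_mem_majoranaSpan {T : Set ℕ} {a : ℕ} (ha : a ∈ T) :
    majorana n a ∈ majoranaSpan n T :=
  Submodule.subset_span ⟨a, ha, rfl⟩

theorem majoranaSpan_mono {S T : Set ℕ} (h : S ⊆ T) : majoranaSpan n S ≤ majoranaSpan n T :=
  Submodule.span_mono (Set.image_mono h)

theorem conjOp_mem_of_mem_majoranaSpan {U : Matrix (Bits n) (Bits n) ℂ} {T : Set ℕ}
    {M : Submodule ℂ (Matrix (Bits n) (Bits n) ℂ)}
    (h : ∀ a ∈ T, conjOp U (majorana n a) ∈ M) {B : Matrix (Bits n) (Bits n) ℂ}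
    (hB : B ∈ majoranaSpan n T) : conjOp U B ∈ M := by
  have : majoranaSpan n T ≤ M.comap (conjOp U) := by
    rw [majoranaSpan, Submodule.span_le]
    rintro _ ⟨a, ha, rfl⟩
    exact h a ha
  exact this hB

/-- The condition is closed because a subspace of a finite-dimensional space is closed, so it passes
from the generators to the topological closure. -/
theorem matchgateGroup_conjOp_majorana {U : QubitUnitary n} (hU : U ∈ matchgateGroup n) :
    ∀ a < 2 * n, conjOp (U : Matrix (Bits n) (Bits n) ℂ) (majorana n a) ∈
      majoranaSpan n (Set.Iio (2 * n)) := by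
  refine matchgateGroup_induction (p := fun U : QubitUnitary n => ∀ a < 2 * n,
    conjOp (U : Matrix (Bits n) (Bits n) ℂ) (majorana n a) ∈ majoranaSpan n (Set.Iio (2 * n)))
    ?_ ?_ ?_ ?_ hU
  · simp only [Set.ofPred_forall]
    exact isClosed_iInter fun a => isClosed_iInter fun _ =>
      (Submodule.closed_of_finiteDimensional _).preimage (continuous_conjOp _)
  · intro a ha
    rw [OneMemClass.coe_one, conjOp_one]
    exact majorana_mem_majoranaSpan ha
  · intro U V hU hV a ha
    rw [Submonoid.coe_mul, conjOp_mul_apply]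
    exact conjOp_mem_of_mem_majoranaSpan (fun b hb => hU b hb) (hV a ha)
  · intro k θ U hk h a ha
    have hmem : ∀ (r : ℝ) {b : ℕ}, b < 2 * n →
        r • majorana n b ∈ majoranaSpan n (Set.Iio (2 * n)) := by
      intro r b hb
      rw [← Complex.coe_smul]
      exact Submodule.smul_mem _ _ (majorana_mem_majoranaSpan hb)
    rw [h]
    by_cases h1 : a = k
    · subst h1
      rw [conjOp_majoranaRotation_self hk]
      exact Submodule.sub_mem _ (hmem _ ha) (hmem _ hk)
    by_cases h2 : a = k + 1
    · subst h2
      rw [conjOp_majoranaRotation_succ hk]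
      exact Submodule.add_mem _ (hmem _ ha) (hmem _ (by omega))
    · rw [conjOp_majoranaRotation_of_ne hk ha h1 h2]
      exact majorana_mem_majoranaSpan ha

end MatchgateGroup

/-! ### The light cone of a shallow circuit -/

section LightCone

variable {n : ℕ}

theorem trace_eq_zero_of_anticomm {κ : Type} [Fintype κ] [DecidableEq κ] {A B : Matrix κ κ ℂ}
    (hB : B * B = 1) (h : A * B = -(B * A)) : A.trace = 0 := by
  have h1 : A.trace = -A.trace := by
    calc A.trace = (A * B * B).trace := by rw [mul_assoc, hB, mul_one]
      _ = -A.trace := by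
        rw [h, neg_mul, Matrix.trace_neg, Matrix.trace_mul_comm, ← mul_assoc, hB, one_mul]
  exact self_eq_neg.1 h1

theorem trace_majorana_mul_of_ne {a b : ℕ} (ha : a < 2 * n) (hb : b < 2 * n) (hab : a ≠ b) :
    (majorana n a * majorana n b).trace = 0 := by
  refine trace_eq_zero_of_anticomm (majorana_mul_self hb) ?_
  rw [← mul_assoc, ← neg_mul, ← majorana_anticomm ha hb hab]

theorem trace_one_bits_ne_zero : (1 : Matrix (Bits n) (Bits n) ℂ).trace ≠ 0 := by
  rw [Matrix.trace_one]
  exact_mod_cast Fintype.card_ne_zero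

/-- The trace of B γ_b reads off the coefficient of γ_b up to a nonzero factor; anticommutation and
cyclicity force it to vanish. -/
theorem mem_majoranaSpan_of_anticomm {T : Set ℕ} {B : Matrix (Bits n) (Bits n) ℂ}
    (hB : B ∈ majoranaSpan n (Set.Iio (2 * n)))
    (h : ∀ b < 2 * n, b ∉ T → B * majorana n b = -(majorana n b * B)) :
    B ∈ majoranaSpan n (Set.Iio (2 * n) ∩ T) := by
  rw [← Finset.coe_Iio, majoranaSpan, Submodule.mem_span_image_finset_iff_exists_fun'] at hB
  obtain ⟨c, rfl⟩ := hB
  refine Submodule.sum_mem _ fun b hb => ?_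
  rw [Finset.mem_Iio] at hb
  by_cases hbT : b ∈ T
  · exact Submodule.smul_mem _ _ (majorana_mem_majoranaSpan ⟨hb, hbT⟩)
  · set B := ∑ a ∈ Finset.Iio (2 * n), c a • majorana n a with hBdef
    have h1 : (B * majorana n b).trace = 0 := by
      have h2 : (B * majorana n b).trace = -(B * majorana n b).trace := by
        conv_lhs => rw [h b hb hbT, Matrix.trace_neg, Matrix.trace_mul_comm]
      exact self_eq_neg.1 h2
    rw [hBdef, Finset.sum_mul, Matrix.trace_sum, Finset.sum_eq_single b] at h1
    · rw [Matrix.smul_mul, majorana_mul_self hb, Matrix.trace_smul, smul_eq_mul,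
        mul_eq_zero, or_iff_left trace_one_bits_ne_zero] at h1
      rw [h1, zero_smul]
      exact Submodule.zero_mem _
    · intro a ha hab
      rw [Matrix.smul_mul, Matrix.trace_smul, trace_majorana_mul_of_ne (Finset.mem_Iio.1 ha) hb hab,
        smul_zero]
    · intro hb'
      exact absurd (Finset.mem_Iio.2 hb) hb'

/-- The Majorana labels whose site lies in `T`. -/
def siteLabels (n : ℕ) (T : Set ℕ) : Set ℕ := Set.Iio (2 * n) ∩ {a | a / 2 ∈ T}

theorem siteLabels_mono {S T : Set ℕ} (h : S ⊆ T) : siteLabels n S ⊆ siteLabels n T :=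
  fun _ ha => ⟨ha.1, h ha.2⟩

/-- The sites in `S`, as natural numbers. -/
def siteSet (S : Finset (Fin n)) : Set ℕ := Fin.val '' (S : Set (Fin n))

variable {S : Finset (Fin n)} {g : QubitUnitary n}

/-- A gate to the right of the Majorana's site does not meet its string. A gate to the left lies
inside the string; multiplying by the parity, which commutes with the gate, replaces the string by
one that avoids it. -/
theorem IsLocalGate.conjOp_majorana_of_notMem (hg : IsLocalGate (matchgateGroup n) S g) {a : ℕ}
    (haS : a / 2 ∉ siteSet S) :
    conjOp (g : Matrix (Bits n) (Bits n) ℂ) (majorana n a) = majorana n a := by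
  obtain ⟨hG, hsupp, j, hj⟩ := hg
  have hne : ∀ i ∈ S, (i : ℕ) ≠ a / 2 := fun i hi h => haS ⟨i, hi, h⟩
  have hu : ∀ i ∈ S, siteBits n (a / 2) i = 0 := fun i hi => by simp [siteBits, hne i hi]
  refine conjOp_eq_self_of_commute _ ?_
  by_cases hlow : ∀ i ∈ S, a / 2 < (i : ℕ)
  · rw [majorana, Matrix.mul_smul, Matrix.smul_mul, hsupp.commute_pauliString hu]
    intro i hi
    have := hlow i hi
    simp only [lowBits]
    rw [if_neg (by omega)]
  · push Not at hlow
    obtain ⟨i₀, hi₀, hi₀a⟩ := hlow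
    -- S lies in a neighbouring pair and misses the site a / 2, so it cannot have points on both
    -- sides of it.
    have hhigh : ∀ i ∈ S, (i : ℕ) < a / 2 := by
      intro i hi
      have h1 := hne i hi
      have h2 := hne i₀ hi₀
      have h3 := hj i hi
      have h4 := hj i₀ hi₀
      simp only [Fin.ext_iff] at h3 h4
      omega
    have hcomm : (g : Matrix (Bits n) (Bits n) ℂ) * (parityOp n * majorana n a) =
        parityOp n * majorana n a * g := by
      rw [majorana, parityOp, Matrix.mul_smul, pauliString_mul, Matrix.mul_smul, Matrix.mul_smul,
        Matrix.smul_mul, Matrix.smul_mul, hsupp.commute_pauliString]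
      · intro i hi
        rw [zero_add, hu i hi]
      · intro i hi
        have := hhigh i hi
        simp only [lowBits, Pi.add_apply]
        rw [if_pos i.2, if_pos (by omega)]
        rfl
    have hγ : majorana n a = parityOp n * (parityOp n * majorana n a) := by
      rw [← mul_assoc, parityOp_mul_self, one_mul]
    rw [hγ, ← mul_assoc, matchgateGroup_commute_parityOp hG, mul_assoc, hcomm]
    simp only [mul_assoc]

/-- Conjugation preserves anticommutation and fixes every Majorana outside S, so the image still
anticommutes with all of those. -/
theorem IsLocalGate.conjOp_majorana_of_mem (hg : IsLocalGate (matchgateGroup n) S g) {a : ℕ}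
    (ha : a < 2 * n) (haS : a / 2 ∈ siteSet S) :
    conjOp (g : Matrix (Bits n) (Bits n) ℂ) (majorana n a) ∈
      majoranaSpan n (siteLabels n (siteSet S)) := by
  refine mem_majoranaSpan_of_anticomm (matchgateGroup_conjOp_majorana hg.1 a ha) ?_
  intro b hb hbS
  have hab : a ≠ b := by
    rintro rfl
    exact hbS haS
  rw [← hg.conjOp_majorana_of_notMem hbS, ← conjOp_mul, ← conjOp_mul,
    majorana_anticomm ha hb hab, map_neg]

theorem IsLocalGate.conjOp_eq_self_of_disjoint (hg : IsLocalGate (matchgateGroup n) S g)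
    {T : Set ℕ} (hT : Disjoint (siteSet S) T) {B : Matrix (Bits n) (Bits n) ℂ}
    (hB : B ∈ majoranaSpan n (siteLabels n T)) :
    conjOp (g : Matrix (Bits n) (Bits n) ℂ) B = B := by
  have : majoranaSpan n (siteLabels n T) ≤
      LinearMap.eqLocus (conjOp (g : Matrix (Bits n) (Bits n) ℂ)) LinearMap.id := by
    rw [majoranaSpan, Submodule.span_le]
    rintro _ ⟨a, ha, rfl⟩
    exact hg.conjOp_majorana_of_notMem fun h => Set.disjoint_left.1 hT h ha.2
  exact this hB

theorem IsLocalGate.conjOp_mem_majoranaSpan (hg : IsLocalGate (matchgateGroup n) S g)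
    {T : Set ℕ} {B : Matrix (Bits n) (Bits n) ℂ} (hB : B ∈ majoranaSpan n (siteLabels n T)) :
    conjOp (g : Matrix (Bits n) (Bits n) ℂ) B ∈ majoranaSpan n (siteLabels n (siteSet S ∪ T)) := by
  refine conjOp_mem_of_mem_majoranaSpan (fun a ha => ?_) hB
  by_cases haS : a / 2 ∈ siteSet S
  · exact majoranaSpan_mono (siteLabels_mono Set.subset_union_left)
      (hg.conjOp_majorana_of_mem ha.1 haS)
  · rw [hg.conjOp_majorana_of_notMem haS]
    exact majorana_mem_majoranaSpan ⟨ha.1, Or.inr ha.2⟩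

/-- The union of `T` and the supports of the gates that meet `T`. -/
def gateReach (T : Set ℕ) (gates : List (Finset (Fin n) × QubitUnitary n)) : Set ℕ :=
  T ∪ {i | ∃ g ∈ gates, i ∈ siteSet g.1 ∧ ¬ Disjoint (siteSet g.1) T}

/-- A gate that misses T also misses the reach of the gates applied before it, as supports in a
layer are disjoint, and so acts trivially. A gate that meets T adds only its own support.
Disjointness thus prevents spreading through a chain of gates within one layer. -/
theorem conjOp_gates_mem_majoranaSpan (T : Set ℕ) {B : Matrix (Bits n) (Bits n) ℂ}
    (hB : B ∈ majoranaSpan n (siteLabels n T))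
    (gates : List (Finset (Fin n) × QubitUnitary n))
    (hdisj : gates.Pairwise fun g h => Disjoint g.1 h.1)
    (hgates : ∀ g ∈ gates, IsLocalGate (matchgateGroup n) g.1 g.2) :
    conjOp ((gates.map Prod.snd).prod : QubitUnitary n) B ∈
      majoranaSpan n (siteLabels n (gateReach T gates)) := by
  induction gates with
  | nil =>
    rw [List.map_nil, List.prod_nil, OneMemClass.coe_one, conjOp_one]
    exact majoranaSpan_mono (siteLabels_mono Set.subset_union_left) hB
  | cons g gates ih =>
    rw [List.pairwise_cons] at hdisj
    have ih' := ih hdisj.2 fun h hh => hgates h (List.mem_cons_of_mem _ hh)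
    have hg := hgates g List.mem_cons_self
    have hsub : gateReach T gates ⊆ gateReach T (g :: gates) := by
      rintro i (hi | ⟨h, hh, hi⟩)
      · exact Or.inl hi
      · exact Or.inr ⟨h, List.mem_cons_of_mem _ hh, hi⟩
    rw [List.map_cons, List.prod_cons, Submonoid.coe_mul, conjOp_mul_apply]
    by_cases hgT : Disjoint (siteSet g.1) T
    · rw [hg.conjOp_eq_self_of_disjoint _ ih']
      · exact majoranaSpan_mono (siteLabels_mono hsub) ih'
      · refine Set.disjoint_union_right.2 ⟨hgT, Set.disjoint_left.2 ?_⟩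
        rintro _ ⟨i, hi, rfl⟩ ⟨h, hh, ⟨i', hi', hii'⟩, -⟩
        rw [Fin.val_injective hii'] at hi'
        exact Finset.disjoint_left.1 (hdisj.1 h hh) hi hi'
    · refine majoranaSpan_mono (siteLabels_mono ?_) (hg.conjOp_mem_majoranaSpan ih')
      exact Set.union_subset (fun i hi => Or.inr ⟨g, List.mem_cons_self, hi, hgT⟩) hsub

/-- A gate that meets the initial segment below q occupies neighbouring sites, so it reaches at most
site q. -/
theorem IsLayer.conjOp_mem_majoranaSpan {W : QubitUnitary n} (hW : IsLayer (matchgateGroup n) W)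
    {q : ℕ} {B : Matrix (Bits n) (Bits n) ℂ}
    (hB : B ∈ majoranaSpan n (siteLabels n (Set.Iio q))) :
    conjOp (W : Matrix (Bits n) (Bits n) ℂ) B ∈
      majoranaSpan n (siteLabels n (Set.Iio (q + 1))) := by
  obtain ⟨gates, hdisj, hgates, rfl⟩ := hW
  refine majoranaSpan_mono (siteLabels_mono ?_)
    (conjOp_gates_mem_majoranaSpan _ hB gates hdisj hgates)
  rintro i (hi | ⟨g, hg, ⟨i, hi, rfl⟩, hmeet⟩)
  · exact Nat.lt_succ_of_lt hi
  · obtain ⟨_, ⟨i', hi', rfl⟩, hi'q⟩ := Set.not_disjoint_iff.1 hmeet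
    obtain ⟨-, -, j, hj⟩ := hgates g hg
    have h1 := hj i hi
    have h2 := hj i' hi'
    simp only [Fin.ext_iff, Set.mem_Iio] at h1 h2 hi'q ⊢
    omega

theorem IsCircuitOfDepth.conjOp_mem_majoranaSpan {L : ℕ} {U : QubitUnitary n}
    (hU : IsCircuitOfDepth (matchgateGroup n) L U) {q : ℕ} {B : Matrix (Bits n) (Bits n) ℂ}
    (hB : B ∈ majoranaSpan n (siteLabels n (Set.Iio q))) :
    conjOp (U : Matrix (Bits n) (Bits n) ℂ) B ∈
      majoranaSpan n (siteLabels n (Set.Iio (q + L))) := by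
  obtain ⟨layers, rfl, hlayers, rfl⟩ := hU
  induction layers with
  | nil => simpa [conjOp_one] using hB
  | cons W layers ih =>
    rw [List.prod_cons, Submonoid.coe_mul, conjOp_mul_apply, List.length_cons, ← add_assoc]
    exact (hlayers W List.mem_cons_self).conjOp_mem_majoranaSpan
      (ih fun V hV => hlayers V (List.mem_cons_of_mem _ hV))

theorem IsLayer.mem {G : Subgroup (QubitUnitary n)} {W : QubitUnitary n} (hW : IsLayer G W) :
    W ∈ G := by
  obtain ⟨gates, -, hgates, rfl⟩ := hW
  refine Subgroup.list_prod_mem _ fun g hg => ?_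
  obtain ⟨h, hh, rfl⟩ := List.mem_map.1 hg
  exact (hgates h hh).1

theorem IsCircuitOfDepth.mem {G : Subgroup (QubitUnitary n)} {L : ℕ} {U : QubitUnitary n}
    (hU : IsCircuitOfDepth G L U) : U ∈ G := by
  obtain ⟨layers, -, hlayers, rfl⟩ := hU
  exact Subgroup.list_prod_mem _ fun W hW => (hlayers W hW).mem

end LightCone

/-! ### Products of two Majoranas -/

section Bivectors

variable {n : ℕ}

/-- The pairs `a < b < m`. -/
def orderedPairs (m : ℕ) : Finset (ℕ × ℕ) :=
  (Finset.range m ×ˢ Finset.range m).filter fun p => p.1 < p.2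

theorem mem_orderedPairs {m : ℕ} {p : ℕ × ℕ} : p ∈ orderedPairs m ↔ p.1 < p.2 ∧ p.2 < m := by
  simp only [orderedPairs, Finset.mem_filter, Finset.mem_product, Finset.mem_range]
  omega

theorem orderedPairs_mono {l m : ℕ} (h : l ≤ m) : orderedPairs l ⊆ orderedPairs m := by
  intro p
  simp only [mem_orderedPairs]
  omega

theorem card_orderedPairs (m : ℕ) : 2 * (orderedPairs m).card + m = m * m := by
  induction m with
  | zero => rfl
  | succ m ih =>
    have : orderedPairs (m + 1) = orderedPairs m ∪ (Finset.range m).image fun a => (a, m) := by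
      ext ⟨a, b⟩
      simp only [mem_orderedPairs, Finset.mem_union, Finset.mem_image, Finset.mem_range,
        Prod.mk.injEq]
      constructor
      · intro h
        by_cases hb : b < m
        · exact Or.inl ⟨h.1, hb⟩
        · exact Or.inr ⟨a, by omega, rfl, by omega⟩
      · rintro (h | ⟨c, hc, rfl, rfl⟩) <;> omega
    rw [this, Finset.card_union_of_disjoint, Finset.card_image_of_injective, Finset.card_range]
    · linarith
    · intro a b h
      exact (Prod.mk.inj h).1
    · rw [Finset.disjoint_left]
      rintro ⟨a, b⟩ h1 h2
      simp only [mem_orderedPairs, Finset.mem_image, Finset.mem_range, Prod.mk.injEq] at h1 h2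
      omega

/-- The product of two Majorana operators. -/
def bivector (n : ℕ) (p : ℕ × ℕ) : Matrix (Bits n) (Bits n) ℂ := majorana n p.1 * majorana n p.2

theorem bivector_conjTranspose_mul_self {p : ℕ × ℕ} (hp : p ∈ orderedPairs (2 * n)) :
    (bivector n p).conjTranspose * bivector n p = 1 := by
  rw [mem_orderedPairs] at hp
  rw [bivector, Matrix.conjTranspose_mul, majorana_conjTranspose hp.2,
    majorana_conjTranspose (hp.1.trans hp.2), mul_assoc, ← mul_assoc (majorana n p.1),
    majorana_mul_self (hp.1.trans hp.2), one_mul, majorana_mul_self hp.2]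

theorem trace_bivector {p : ℕ × ℕ} (hp : p ∈ orderedPairs (2 * n)) : (bivector n p).trace = 0 := by
  rw [mem_orderedPairs] at hp
  exact trace_majorana_mul_of_ne (hp.1.trans hp.2) hp.2 hp.1.ne

theorem bivector_commute_majorana {p : ℕ × ℕ} (hp : p ∈ orderedPairs (2 * n)) {e : ℕ}
    (he : e < 2 * n) (h1 : e ≠ p.1) (h2 : e ≠ p.2) :
    bivector n p * majorana n e = majorana n e * bivector n p := by
  rw [mem_orderedPairs] at hp
  rw [bivector, mul_assoc, majorana_anticomm hp.2 he h2.symm, mul_neg, ← mul_assoc,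
    majorana_anticomm (hp.1.trans hp.2) he h1.symm, neg_mul, neg_neg, mul_assoc]

theorem bivector_anticomm_majorana {p : ℕ × ℕ} (hp : p ∈ orderedPairs (2 * n)) {e : ℕ}
    (h : e = p.1 ∨ e = p.2) :
    bivector n p * majorana n e = -(majorana n e * bivector n p) := by
  rw [mem_orderedPairs] at hp
  have h1 := hp.1.trans hp.2
  rcases h with rfl | rfl
  · rw [bivector, mul_assoc, majorana_anticomm hp.2 h1 hp.1.ne', mul_neg]
  · rw [bivector, ← mul_assoc, majorana_anticomm hp.2 h1 hp.1.ne', neg_mul, neg_neg]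

theorem trace_bivector_conjTranspose_mul_of_ne {p q : ℕ × ℕ} (hp : p ∈ orderedPairs (2 * n))
    (hq : q ∈ orderedPairs (2 * n)) (hpq : p ≠ q) :
    ((bivector n p).conjTranspose * bivector n q).trace = 0 := by
  have hstar : ∀ r ∈ orderedPairs (2 * n), (bivector n r).conjTranspose = -bivector n r := by
    intro r hr
    rw [mem_orderedPairs] at hr
    rw [bivector, Matrix.conjTranspose_mul, majorana_conjTranspose hr.2,
      majorana_conjTranspose (hr.1.trans hr.2), majorana_anticomm hr.2 (hr.1.trans hr.2) hr.1.ne']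
  have hp' := mem_orderedPairs.1 hp
  have hq' := mem_orderedPairs.1 hq
  -- Distinct ordered pairs differ in some label e of p. Then γ_e anticommutes with one bivector and
  -- commutes with the other, so their product is traceless.
  obtain ⟨e, he, hep, heq1, heq2⟩ : ∃ e < 2 * n, (e = p.1 ∨ e = p.2) ∧ e ≠ q.1 ∧ e ≠ q.2 := by
    by_contra! hcon
    have h1 := hcon p.1 (hp'.1.trans hp'.2) (Or.inl rfl)
    have h2 := hcon p.2 hp'.2 (Or.inr rfl)
    refine hpq (Prod.ext ?_ ?_) <;> omega
  rw [hstar p hp, neg_mul, Matrix.trace_neg, neg_eq_zero]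
  refine trace_eq_zero_of_anticomm (majorana_mul_self he) ?_
  rw [mul_assoc, bivector_commute_majorana hq he heq1 heq2, ← mul_assoc,
    bivector_anticomm_majorana hp hep, neg_mul, mul_assoc]

/-- The product expands into bivectors and a multiple of the identity; bivectors are traceless, so
the trace hypothesis removes the identity part. -/
theorem mul_mem_bivector_span {m : ℕ} (hm : m ≤ 2 * n) {x y : Matrix (Bits n) (Bits n) ℂ}
    (hx : x ∈ majoranaSpan n (Set.Iio m)) (hy : y ∈ majoranaSpan n (Set.Iio m))
    (hxy : (x * y).trace = 0) :
    x * y ∈ Submodule.span ℂ (bivector n '' orderedPairs m) := by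
  have h1 : x * y ∈ Submodule.span ℂ (bivector n '' orderedPairs m) ⊔
      Submodule.span ℂ {(1 : Matrix (Bits n) (Bits n) ℂ)} := by
    have h2 := Submodule.mul_mem_mul hx hy
    rw [majoranaSpan, Submodule.span_mul_span] at h2
    refine Submodule.span_le.2 ?_ h2
    rintro _ ⟨_, ⟨a, ha, rfl⟩, _, ⟨b, hb, rfl⟩, rfl⟩
    simp only [Set.mem_Iio] at ha hb
    have hmem : ∀ {a b : ℕ}, a < b → b < m → majorana n a * majorana n b ∈
        Submodule.span ℂ (bivector n '' orderedPairs m) := fun {a b} hab hb =>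
      Submodule.subset_span ⟨(a, b), mem_orderedPairs.2 ⟨hab, hb⟩, rfl⟩
    rcases lt_trichotomy a b with hab | rfl | hab
    · exact Submodule.mem_sup_left (hmem hab hb)
    · change majorana n a * majorana n a ∈ _
      rw [majorana_mul_self (by omega)]
      exact Submodule.mem_sup_right (Submodule.mem_span_singleton_self _)
    · change majorana n a * majorana n b ∈ _
      rw [majorana_anticomm (by omega) (by omega) hab.ne']
      exact Submodule.mem_sup_left (Submodule.neg_mem _ (hmem hab ha))
  obtain ⟨β, hβ, z, hz, hβz⟩ := Submodule.mem_sup.1 h1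
  obtain ⟨c, rfl⟩ := Submodule.mem_span_singleton.1 hz
  have hβ0 : β.trace = 0 := by
    have : Submodule.span ℂ (bivector n '' orderedPairs m) ≤
        LinearMap.ker (Matrix.traceLinearMap (Bits n) ℂ ℂ) := by
      rw [Submodule.span_le]
      rintro _ ⟨p, hp, rfl⟩
      exact trace_bivector (orderedPairs_mono hm hp)
    exact this hβ
  rw [← hβz, Matrix.trace_add, hβ0, zero_add, Matrix.trace_smul, smul_eq_mul, mul_eq_zero,
    or_iff_left trace_one_bits_ne_zero] at hxy
  rwa [← hβz, hxy, zero_smul, add_zero]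

/-- Starting at the end of the line makes the cone grow in one direction only, to L + 1 sites with
two labels each. -/
theorem IsCircuitOfDepth.conjOp_bivector_mem {L : ℕ} {U : QubitUnitary n}
    (hU : IsCircuitOfDepth (matchgateGroup n) L U) (hL : L + 1 ≤ n) :
    conjOp (U : Matrix (Bits n) (Bits n) ℂ) (bivector n (0, 1)) ∈
      Submodule.span ℂ (bivector n '' orderedPairs (2 * (L + 1))) := by
  have hmaj : ∀ a < 2, conjOp (U : Matrix (Bits n) (Bits n) ℂ) (majorana n a) ∈
      majoranaSpan n (Set.Iio (2 * (L + 1))) := by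
    intro a ha
    refine majoranaSpan_mono ?_ (hU.conjOp_mem_majoranaSpan (q := 1)
      (majorana_mem_majoranaSpan ⟨show a < 2 * n by omega, show a / 2 < 1 by omega⟩))
    intro b hb
    have : b / 2 < 1 + L := hb.2
    simp only [Set.mem_Iio]
    omega
  have h0 : (bivector n (0, 1)).trace = 0 :=
    trace_bivector (mem_orderedPairs.2 ⟨one_pos, by omega⟩)
  rw [← trace_conjOp U] at h0
  rw [bivector, conjOp_mul] at h0 ⊢
  exact mul_mem_bivector_span (by omega) (hmaj 0 (by norm_num)) (hmaj 1 (by norm_num)) h0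

end Bivectors

/-! ### Bivectors as two-copy states -/

section TwistedVectorization

variable {n : ℕ}

/-- The normalised vectorisation of `A` twisted by the charge conjugation; under `U ⊗ U`, for `U`
in the matchgate group, it transforms like `A` under conjugation. -/
def twistedVec (n : ℕ) : Matrix (Bits n) (Bits n) ℂ →ₗ[ℂ] (Bits n × Bits n → ℂ) where
  toFun A := ((Real.sqrt (Fintype.card (Bits n)) : ℝ) : ℂ)⁻¹ • Matrix.vec (A * chargeConj n)
  map_add' A B := by rw [add_mul, Matrix.vec_add, smul_add]
  map_smul' c A := by rw [Matrix.smul_mul, Matrix.vec_smul, smul_comm]; rfl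

theorem twistedVec_apply (A : Matrix (Bits n) (Bits n) ℂ) : twistedVec n A =
    ((Real.sqrt (Fintype.card (Bits n)) : ℝ) : ℂ)⁻¹ • Matrix.vec (A * chargeConj n) := rfl

theorem star_twistedVec_dotProduct (A B : Matrix (Bits n) (Bits n) ℂ) :
    star (twistedVec n A) ⬝ᵥ twistedVec n B =
      (Fintype.card (Bits n) : ℂ)⁻¹ * (A.conjTranspose * B).trace := by
  have hN : ((Real.sqrt (Fintype.card (Bits n)) : ℝ) : ℂ)⁻¹ *
      ((Real.sqrt (Fintype.card (Bits n)) : ℝ) : ℂ)⁻¹ = (Fintype.card (Bits n) : ℂ)⁻¹ := by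
    rw [← mul_inv, ← Complex.ofReal_mul, Real.mul_self_sqrt (Nat.cast_nonneg _),
      Complex.ofReal_natCast]
  rw [twistedVec_apply, twistedVec_apply, star_smul, smul_dotProduct, dotProduct_smul,
    Matrix.star_vec_dotProduct_vec, smul_eq_mul, smul_eq_mul, ← mul_assoc, star_inv₀,
    RCLike.star_def, Complex.conj_ofReal, hN, Matrix.conjTranspose_mul, mul_assoc,
    Matrix.trace_mul_comm, mul_assoc, mul_assoc, chargeConj_mul_conjTranspose, mul_one]

/-- U ⊗ U sends vec(M) to vec(U M Uᵀ); inserting U†U between A and C splits off the conjugate of A,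
and C absorbs the rest. -/
theorem kronecker_mulVec_twistedVec {U : QubitUnitary n} (hU : U ∈ matchgateGroup n)
    (A : Matrix (Bits n) (Bits n) ℂ) :
    ((U : Matrix (Bits n) (Bits n) ℂ) ⊗ₖ (U : Matrix (Bits n) (Bits n) ℂ)).mulVec
      (twistedVec n A) = twistedVec n (conjOp (U : Matrix (Bits n) (Bits n) ℂ) A) := by
  rw [twistedVec_apply, twistedVec_apply, Matrix.mulVec_smul, Matrix.kronecker_mulVec_vec]
  congr 2
  calc (U : Matrix (Bits n) (Bits n) ℂ) * (A * chargeConj n) *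
        (U : Matrix (Bits n) (Bits n) ℂ).transpose
      = (U : Matrix (Bits n) (Bits n) ℂ) * A * ((U : Matrix (Bits n) (Bits n) ℂ).conjTranspose *
          (U : Matrix (Bits n) (Bits n) ℂ)) * chargeConj n *
          (U : Matrix (Bits n) (Bits n) ℂ).transpose := by
        rw [unitary_conjTranspose_mul_self, mul_one]
        simp only [mul_assoc]
    _ = conjOp (U : Matrix (Bits n) (Bits n) ℂ) A * ((U : Matrix (Bits n) (Bits n) ℂ) *
          chargeConj n * (U : Matrix (Bits n) (Bits n) ℂ).transpose) := by
        simp only [conjOp_apply, mul_assoc]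
    _ = _ := by rw [matchgateGroup_mul_chargeConj hU]

theorem isOrthonormalOn_twistedVec_bivector :
    IsOrthonormalOn (orderedPairs (2 * n)) fun p => twistedVec n (bivector n p) := by
  intro p hp q hq
  rw [star_twistedVec_dotProduct]
  split_ifs with h
  · rw [← h, bivector_conjTranspose_mul_self hp, Matrix.trace_one]
    exact inv_mul_cancel₀ (Nat.cast_ne_zero.2 Fintype.card_ne_zero)
  · rw [trace_bivector_conjTranspose_mul_of_ne hp hq h, mul_zero]

end TwistedVectorization

/-! ### Haar averages of bivector overlaps -/

section HaarOverlap

variable {n : ℕ}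

/-- The squared overlap of `A` with `U B U†`. -/
def overlap (B A : Matrix (Bits n) (Bits n) ℂ) (U : QubitUnitary n) : ℝ :=
  ‖(Fintype.card (Bits n) : ℂ)⁻¹ *
    (A.conjTranspose * conjOp (U : Matrix (Bits n) (Bits n) ℂ) B).trace‖ ^ 2

theorem continuous_overlap (B A : Matrix (Bits n) (Bits n) ℂ) : Continuous (overlap B A) :=
  ((continuous_const.mul (continuous_const.mul (continuous_conjOp B)).matrix_trace).norm).pow 2

theorem integrable_overlap (B A : Matrix (Bits n) (Bits n) ℂ) (μ : Measure (QubitUnitary n))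
    [IsFiniteMeasure μ] : Integrable (overlap B A) μ :=
  (continuous_overlap B A).integrable_of_hasCompactSupport (HasCompactSupport.of_compactSpace _)

theorem overlap_neg (B A : Matrix (Bits n) (Bits n) ℂ) (U : QubitUnitary n) :
    overlap B (-A) U = overlap B A U := by
  simp [overlap]

theorem overlap_conjOp_mul (B A : Matrix (Bits n) (Bits n) ℂ) (g U : QubitUnitary n) :
    overlap B (conjOp (g : Matrix (Bits n) (Bits n) ℂ) A) (g * U) = overlap B A U := by
  have h : (conjOp (g : Matrix (Bits n) (Bits n) ℂ) A).conjTranspose =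
      conjOp (g : Matrix (Bits n) (Bits n) ℂ) A.conjTranspose := by
    simp only [conjOp_apply, Matrix.conjTranspose_mul, Matrix.conjTranspose_conjTranspose,
      mul_assoc]
  rw [overlap, overlap, h, Submonoid.coe_mul, conjOp_mul_apply, ← conjOp_mul, trace_conjOp]

/-- The Haar average over the matchgate group of the squared overlap of `A` with `U B U†`. -/
def haarOverlap (B A : Matrix (Bits n) (Bits n) ℂ) : ℝ :=
  ∫ U, overlap B A U ∂haarEnsemble (matchgateGroup n) (isClosed_matchgateGroup n)

theorem haarOverlap_neg (B A : Matrix (Bits n) (Bits n) ℂ) :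
    haarOverlap B (-A) = haarOverlap B A := by
  simp only [haarOverlap, overlap_neg]

theorem haarOverlap_conjOp (B A : Matrix (Bits n) (Bits n) ℂ) {g : QubitUnitary n}
    (hg : g ∈ matchgateGroup n) :
    haarOverlap B (conjOp (g : Matrix (Bits n) (Bits n) ℂ) A) = haarOverlap B A := by
  rw [haarOverlap, ← integral_haarEnsemble_mul_left _ _ hg _ (continuous_overlap _ _)]
  simp only [overlap_conjOp_mul]
  rfl

/-- The angle π/4 doubles to a quarter turn; the resulting sign is invisible to squared overlaps. -/
theorem conjOp_majoranaRotation_pi_div_four {k : ℕ} (hk : k + 1 < 2 * n) :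
    conjOp (majoranaRotation n k (Real.pi / 4)) (majorana n k) = -majorana n (k + 1) := by
  have h : 2 * (Real.pi / 4) = Real.pi / 2 := by ring
  rw [conjOp_majoranaRotation_self hk, h, Real.cos_pi_div_two, Real.sin_pi_div_two, zero_smul,
    one_smul, zero_sub]

theorem haarOverlap_succ_left (B : Matrix (Bits n) (Bits n) ℂ) {a b : ℕ} (hab : a + 1 < b)
    (hb : b < 2 * n) :
    haarOverlap B (bivector n (a + 1, b)) = haarOverlap B (bivector n (a, b)) := by
  have ha : a + 1 < 2 * n := by omega
  rw [← haarOverlap_conjOp B (bivector n (a, b))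
    (majoranaRotation_mem_matchgateGroup ha (Real.pi / 4)), bivector, bivector, conjOp_mul]
  dsimp only
  rw [conjOp_majoranaRotation_pi_div_four ha,
    conjOp_majoranaRotation_of_ne ha hb (by omega) (by omega), neg_mul, haarOverlap_neg]

theorem haarOverlap_succ_right (B : Matrix (Bits n) (Bits n) ℂ) {a b : ℕ} (hab : a < b)
    (hb : b + 1 < 2 * n) :
    haarOverlap B (bivector n (a, b + 1)) = haarOverlap B (bivector n (a, b)) := by
  rw [← haarOverlap_conjOp B (bivector n (a, b))
    (majoranaRotation_mem_matchgateGroup hb (Real.pi / 4)), bivector, bivector, conjOp_mul]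
  dsimp only
  rw [conjOp_majoranaRotation_pi_div_four hb,
    conjOp_majoranaRotation_of_ne hb (by omega) (by omega) (by omega), mul_neg, haarOverlap_neg]

/-- The Haar measure does not distinguish bivectors. -/
theorem haarOverlap_bivector (B : Matrix (Bits n) (Bits n) ℂ) {p : ℕ × ℕ}
    (hp : p ∈ orderedPairs (2 * n)) :
    haarOverlap B (bivector n p) = haarOverlap B (bivector n (0, 1)) := by
  obtain ⟨a, b⟩ := p
  obtain ⟨hab, hb⟩ := mem_orderedPairs.1 hp
  dsimp only at hab hb
  -- The left label descends to 0 first, staying below b throughout; then b descends to 1.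
  have hleft : haarOverlap B (bivector n (a, b)) = haarOverlap B (bivector n (0, b)) := by
    clear hp
    induction a with
    | zero => rfl
    | succ a ih => rw [haarOverlap_succ_left B hab hb, ih (by omega)]
  rw [hleft]
  have hb1 : 1 ≤ b := by omega
  clear hleft hab hp
  induction b, hb1 using Nat.le_induction with
  | base => rfl
  | succ b hb1 ih => rw [haarOverlap_succ_right B (by omega) hb, ih (by omega)]

theorem norm_star_twistedVec_dotProduct_sq (A B : Matrix (Bits n) (Bits n) ℂ) {U : QubitUnitary n}
    (hU : U ∈ matchgateGroup n) :
    ‖star (twistedVec n A) ⬝ᵥ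
      ((U : Matrix (Bits n) (Bits n) ℂ) ⊗ₖ (U : Matrix (Bits n) (Bits n) ℂ)).mulVec
        (twistedVec n B)‖ ^ 2 = overlap B A U := by
  rw [kronecker_mulVec_twistedVec hU, star_twistedVec_dotProduct, overlap]

theorem sum_overlap_le_one {p : ℕ × ℕ} (hp : p ∈ orderedPairs (2 * n)) {U : QubitUnitary n}
    (hU : U ∈ matchgateGroup n) :
    ∑ q ∈ orderedPairs (2 * n), overlap (bivector n p) (bivector n q) U ≤ 1 := by
  have h := isOrthonormalOn_twistedVec_bivector.sum_norm_sq_le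
    (((U : Matrix (Bits n) (Bits n) ℂ) ⊗ₖ (U : Matrix (Bits n) (Bits n) ℂ)).mulVec
      (twistedVec n (bivector n p)))
  simp only [norm_star_twistedVec_dotProduct_sq _ _ hU] at h
  refine h.trans_eq ?_
  have hstar : (conjOp (U : Matrix (Bits n) (Bits n) ℂ) (bivector n p)).conjTranspose =
      conjOp (U : Matrix (Bits n) (Bits n) ℂ) (bivector n p).conjTranspose := by
    simp only [conjOp_apply, Matrix.conjTranspose_mul, Matrix.conjTranspose_conjTranspose,
      mul_assoc]
  rw [kronecker_mulVec_twistedVec hU, star_twistedVec_dotProduct, hstar, ← conjOp_mul,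
    trace_conjOp, ← star_twistedVec_dotProduct, isOrthonormalOn_twistedVec_bivector p hp p hp]
  simp

/-- Bessel's inequality, averaged over the group, bounds a sum whose terms are all equal. -/
theorem card_mul_haarOverlap_le_one {p : ℕ × ℕ} (hp : p ∈ orderedPairs (2 * n)) :
    ((orderedPairs (2 * n)).card : ℝ) * haarOverlap (bivector n p) (bivector n (0, 1)) ≤ 1 := by
  have h1 : ∑ q ∈ orderedPairs (2 * n), haarOverlap (bivector n p) (bivector n q) ≤ 1 := by
    simp only [haarOverlap]
    rw [← integral_finsetSum _ fun q _ => integrable_overlap _ _ _]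
    calc _ ≤ ∫ _, (1 : ℝ) ∂haarEnsemble (matchgateGroup n) (isClosed_matchgateGroup n) := by
          refine integral_mono_ae (integrable_finsetSum _ fun q _ => integrable_overlap _ _ _)
            (integrable_const _) ?_
          filter_upwards [ae_mem_haarEnsemble _ (isClosed_matchgateGroup n)] with U hU
          exact sum_overlap_le_one hp hU
      _ = 1 := by simp
  rwa [Finset.sum_congr rfl fun q hq => haarOverlap_bivector _ hq, Finset.sum_const,
    nsmul_eq_mul] at h1

/-- The bound is the ratio of the number of pairs below n + 1, which is n(n + 1)/2, to the number
below 2n, which is n(2n - 1). -/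
theorem integral_sum_overlap_le (hn : 1 ≤ n) {m : ℕ} (hm : m ≤ n + 1) (hmn : m ≤ 2 * n) :
    ∫ U : QubitUnitary n, ∑ q ∈ orderedPairs m, ‖star (twistedVec n (bivector n q)) ⬝ᵥ
      ((U : Matrix (Bits n) (Bits n) ℂ) ⊗ₖ (U : Matrix (Bits n) (Bits n) ℂ)).mulVec
        (twistedVec n (bivector n (0, 1)))‖ ^ 2
        ∂haarEnsemble (matchgateGroup n) (isClosed_matchgateGroup n) ≤
      ((n : ℝ) + 1) / (2 * (2 * (n : ℝ) - 1)) := by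
  have h01 : ((0, 1) : ℕ × ℕ) ∈ orderedPairs (2 * n) :=
    mem_orderedPairs.2 ⟨one_pos, show 1 < 2 * n by omega⟩
  have hae : (fun U : QubitUnitary n => ∑ q ∈ orderedPairs m,
      ‖star (twistedVec n (bivector n q)) ⬝ᵥ
        ((U : Matrix (Bits n) (Bits n) ℂ) ⊗ₖ (U : Matrix (Bits n) (Bits n) ℂ)).mulVec
          (twistedVec n (bivector n (0, 1)))‖ ^ 2)
      =ᵐ[haarEnsemble (matchgateGroup n) (isClosed_matchgateGroup n)]
      fun U => ∑ q ∈ orderedPairs m, overlap (bivector n (0, 1)) (bivector n q) U := by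
    filter_upwards [ae_mem_haarEnsemble _ (isClosed_matchgateGroup n)] with U hU
    simp only [norm_star_twistedVec_dotProduct_sq _ _ hU]
  rw [integral_congr_ae hae, integral_finsetSum _ fun q _ => integrable_overlap _ _ _]
  change ∑ q ∈ orderedPairs m, haarOverlap (bivector n (0, 1)) (bivector n q) ≤ _
  rw [Finset.sum_congr rfl fun q hq => haarOverlap_bivector _ (orderedPairs_mono hmn hq),
    Finset.sum_const, nsmul_eq_mul]
  have hf := card_mul_haarOverlap_le_one h01
  have hf0 : 0 ≤ haarOverlap (bivector n (0, 1)) (bivector n (0, 1)) :=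
    integral_nonneg fun U => by unfold overlap; positivity
  set f := haarOverlap (bivector n (0, 1)) (bivector n (0, 1))
  have hc1 : (2 * ((orderedPairs m).card : ℝ) + m) = m * m := by
    exact_mod_cast card_orderedPairs m
  have hc2 : (2 * ((orderedPairs (2 * n)).card : ℝ) + 2 * n) = 2 * n * (2 * n) := by
    exact_mod_cast card_orderedPairs (2 * n)
  have hn' : (1 : ℝ) ≤ n := by exact_mod_cast hn
  have hm' : (m : ℝ) ≤ n + 1 := by exact_mod_cast hm
  have hc3 : ((orderedPairs m).card : ℝ) ≤ (n + 1) * n / 2 := by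
    have : ((orderedPairs m).card : ℝ) ≤ (orderedPairs (n + 1)).card := by
      exact_mod_cast Finset.card_le_card (orderedPairs_mono hm)
    have hc4 : (2 * ((orderedPairs (n + 1)).card : ℝ) + (n + 1)) = (n + 1) * (n + 1) := by
      exact_mod_cast card_orderedPairs (n + 1)
    linarith
  have hc5 : ((orderedPairs (2 * n)).card : ℝ) = n * (2 * n - 1) := by linarith
  rw [hc5] at hf
  rw [le_div_iff₀ (by linarith)]
  calc _ ≤ ((n : ℝ) + 1) * n / 2 * f * (2 * (2 * n - 1)) := by
        gcongr
        linarith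
    _ = ((n : ℝ) + 1) * (n * (2 * n - 1) * f) := by ring
    _ ≤ ((n : ℝ) + 1) * 1 := by gcongr
    _ = _ := mul_one _

end HaarOverlap

theorem le_twoDesignDistance_of_lt {n : ℕ} (hn : 1 ≤ n) {L : ℕ}
    (ν : Measure (QubitUnitary n)) [IsProbabilityMeasure ν]
    (hν : ∀ᵐ U ∂ν, IsCircuitOfDepth (matchgateGroup n) L U) (hL : (L : ℝ) < (n : ℝ) / 2) :
    ENNReal.ofReal (2 - ((n : ℝ) + 1) / (2 * (n : ℝ) - 1)) ≤
      twoDesignDistance (matchgateGroup n) (isClosed_matchgateGroup n) ν := by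
  -- Over the integers this gives 2(L + 1) ≤ n + 1 ≤ 2n, the size of the light cone allowed in
  -- `integral_sum_overlap_le`.
  have hL' : 2 * L < n := by
    have : (2 * L : ℝ) < n := by linarith
    exact_mod_cast this
  have h := ofReal_le_diamondNorm_sub ν
    (haarEnsemble (matchgateGroup n) (isClosed_matchgateGroup n))
    (isOrthonormalOn_twistedVec_bivector.mono
      (orderedPairs_mono (show 2 * (L + 1) ≤ 2 * n by omega)))
    (i₀ := (0, 1)) (mem_orderedPairs.2 ⟨one_pos, show 1 < 2 * (L + 1) by omega⟩) _ ?_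
    (integral_sum_overlap_le hn (by omega) (by omega))
  · rwa [show (2 : ℝ) * (((n : ℝ) + 1) / (2 * (2 * (n : ℝ) - 1))) =
      ((n : ℝ) + 1) / (2 * (n : ℝ) - 1) by rw [← mul_div_assoc, mul_div_mul_left _ _ two_ne_zero]]
      at h
  · filter_upwards [hν] with U hU
    rw [kronecker_mulVec_twistedVec hU.mem]
    have hmem := Submodule.mem_map_of_mem (f := twistedVec n)
      (hU.conjOp_bivector_mem (show L + 1 ≤ n by omega))
    rwa [Submodule.map_span, Set.image_image] at hmem

end

theorem corollary1 (n : ℕ) (hn : 1 ≤ n) (L : ℕ)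
    (ν : Measure (QubitUnitary n)) [IsProbabilityMeasure ν]
    (hν : ∀ᵐ U ∂ν, IsCircuitOfDepth (matchgateGroup n) L U) :
    ((L : ℝ) < (n : ℝ) / 2 →
      ENNReal.ofReal (2 - ((n : ℝ) + 1) / (2 * (n : ℝ) - 1)) ≤
        twoDesignDistance (matchgateGroup n) (isClosed_matchgateGroup n) ν) ∧
    (∀ ε : ℝ, 0 ≤ ε → ε < 2 - ((n : ℝ) + 1) / (2 * (n : ℝ) - 1) →
      IsApproxTwoDesign (matchgateGroup n) (isClosed_matchgateGroup n) ε ν →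
        (n : ℝ) / 2 ≤ (L : ℝ)) := by
  refine ⟨le_twoDesignDistance_of_lt hn ν hν, fun ε hε hlt happrox => ?_⟩
  by_contra! hL
  have h := (le_twoDesignDistance_of_lt hn ν hν hL).trans happrox
  -- `ENNReal.ofReal` truncates negative reals to 0, so the comparison descends to ℝ because ε is
  -- nonnegative.
  rw [ENNReal.ofReal_le_ofReal_iff hε] at h
  exact absurd hlt h.not_gt
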